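/- Let $\eta\in[0,1]$ and let $\mathcal A$ be the qubit amplitude damping channel of transmissivity $\eta$, i.e. $\mathcal A(\rho)=K_0\rho K_0^\dagger+K_1\rho K_1^\dagger$ with $K_0=|1\rangle\langle 1|+\sqrt{\eta}\,|0\rangle\langle 0|$ and $K_1=\sqrt{1-\eta}\,|1\rangle\langle 0|$. For a finite ensemble $\{p_X(x),|\phi^x\rangle_{AA'}\}$ of pure states, where $A'$ is a qubit and $A$ is a finite-dimensional reference system, put $$\rho_{XAB}=\sum_x p_X(x)\,|x\rangle\langle x|_X\otimes(\mathrm{id}_A\otimes\mathcal A_{A'\to B})(|\phi^x\rangle\langle\phi^x|_{AA'}),$$ and let $I(A\rangle BX)_\rho=H(BX)_\rho-H(ABX)_\rho$ and $I(X;B)_\rho=H(X)_\rho+H(B)_\rho-H(BX)_\rho$, where $H(\cdot)_\rho$ denotes the von Neumann entropy (logarithm to base 2) of the corresponding marginal of $\rho_{XAB}$. The single-letter classical–quantum trade-off region of $\mathcal A$ is the set of all pairs $(C,Q)\in\mathbb R^2$ for which there is such an ensemble with $$Q\le I(A\rangle BX)_\rho,\qquad C+Q\le I(X;B)_\rho+I(A\rangle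 BX)_\rho .$$ This region is equal to the union, over all $p_0,q_0,q_1,\nu_0,\nu_1\in[0,1]$, with $p_1=1-p_0$ and $p=\sum_{x\in\{0,1\}}p_xq_x$, of the polyhedra of all $(C,Q)\in\mathbb R^2$ with $$Q\le\sum_{x\in\{0,1\}}p_x\,[g(q_x,\eta,\nu_x)-g(q_x,1-\eta,\nu_x)],\qquad C+Q\le h_2(\eta p)-\sum_{x\in\{0,1\}}p_x\,g(q_x,1-\eta,\nu_x),$$ where $$g(q,z,\nu)=h_2\!\left(\frac{1+\sqrt{(1-2zq)^2+4z\nu^2q(1-q)}}{2}\right),\qquad h_2(y)=-y\log_2y-(1-y)\log_2(1-y),\quad 0\log_2 0=0.$$ -/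

import Mathlib

open scoped Matrix Kronecker

namespace AmplitudeDamping

noncomputable section

/-- Binary Shannon entropy in bits, `h₂(y) = -y log₂ y - (1-y) log₂ (1-y)`
(`Real.logb 2 0 = 0` gives the convention `0 log 0 = 0`). -/
def h2 (y : ℝ) : ℝ := -y * Real.logb 2 y - (1 - y) * Real.logb 2 (1 - y)

/-- `g(q,z,ν) = h₂((1 + √((1 - 2zq)² + 4zν²q(1-q))) / 2)`. -/
def g (q z ν : ℝ) : ℝ :=
  h2 ((1 + Real.sqrt ((1 - 2 * z * q) ^ 2 + 4 * z * ν ^ 2 * q * (1 - q))) / 2)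

/-- Von Neumann entropy in bits, `-Tr(ρ log₂ ρ)`, by functional calculus of the Hermitian
matrix `ρ`. -/
def vnEntropy {ι : Type*} [Fintype ι] [DecidableEq ι] (ρ : Matrix ι ι ℂ) : ℝ :=
  (Matrix.trace (cfc (fun t : ℝ => -(t * Real.logb 2 t)) ρ)).re

/-- Partial trace over the first tensor factor. -/
def traceFst {ι κ : Type*} [Fintype ι] (M : Matrix (ι × κ) (ι × κ) ℂ) : Matrix κ κ ℂ :=
  Matrix.of fun b b' => ∑ a, M (a, b) (a, b')

/-- Partial trace over the second tensor factor. -/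
def traceSnd {ι κ : Type*} [Fintype κ] (M : Matrix (ι × κ) (ι × κ) ℂ) : Matrix ι ι ℂ :=
  Matrix.of fun a a' => ∑ b, M (a, b) (a', b)

/-- Partial trace over the middle one of three tensor factors. -/
def traceMid {ι κ τ : Type*} [Fintype κ]
    (M : Matrix (ι × κ × τ) (ι × κ × τ) ℂ) : Matrix (ι × τ) (ι × τ) ℂ :=
  Matrix.of fun a a' => ∑ b, M (a.1, b, a.2) (a'.1, b, a'.2)

/-- Kraus operators of the qubit amplitude damping channel of transmissivity `η`, in the basis
`|0⟩, |1⟩`: `K₀ = |1⟩⟨1| + √η |0⟩⟨0|` and `K₁ = √(1-η) |1⟩⟨0|`. -/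
def kraus (η : ℝ) : Fin 2 → Matrix (Fin 2) (Fin 2) ℂ :=
  ![!![(Real.sqrt η : ℂ), 0; 0, 1], !![0, 0; (Real.sqrt (1 - η) : ℂ), 0]]

/-- The channel acting on the second factor of `A ⊗ A'`: `M ↦ ∑ⱼ (1 ⊗ Kⱼ) M (1 ⊗ Kⱼ)†`. -/
def dampSnd {α : Type*} [Fintype α] [DecidableEq α] (η : ℝ)
    (M : Matrix (α × Fin 2) (α × Fin 2) ℂ) : Matrix (α × Fin 2) (α × Fin 2) ℂ :=
  ∑ j, ((1 : Matrix α α ℂ) ⊗ₖ kraus η j) * M * ((1 : Matrix α α ℂ) ⊗ₖ kraus η j)ᴴ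

/-- A finite ensemble `{p_X(x), |φˣ⟩_{AA'}}` of pure bipartite states, with `A'` a qubit, over an
alphabet of `n` letters and with a reference system `A` of dimension `d`. -/
structure Ensemble (n d : ℕ) where
  /-- the letter distribution -/
  prob : Fin n → ℝ
  prob_nonneg : ∀ x, 0 ≤ prob x
  prob_sum : ∑ x, prob x = 1
  /-- the state vector of each letter -/
  vec : Fin n → Fin d × Fin 2 → ℂ
  vec_norm : ∀ x, ∑ i, ‖vec x i‖ ^ 2 = 1

namespace Ensemble

variable {n d : ℕ}

/-- `ρ_{XAB} = ∑ₓ p_X(x) |x⟩⟨x|_X ⊗ (id_A ⊗ 𝒜)(|φˣ⟩⟨φˣ|_{AA'})`. -/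
def stateXAB (η : ℝ) (e : Ensemble n d) :
    Matrix (Fin n × Fin d × Fin 2) (Fin n × Fin d × Fin 2) ℂ :=
  ∑ x, (e.prob x : ℂ) •
    (Matrix.single x x (1 : ℂ) ⊗ₖ
      dampSnd η (Matrix.vecMulVec (e.vec x) (star (e.vec x))))

/-- `ρ_{XB}`. -/
def stateXB (η : ℝ) (e : Ensemble n d) : Matrix (Fin n × Fin 2) (Fin n × Fin 2) ℂ :=
  traceMid (e.stateXAB η)

/-- `ρ_X`. -/
def stateX (η : ℝ) (e : Ensemble n d) : Matrix (Fin n) (Fin n) ℂ :=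
  traceSnd (e.stateXB η)

/-- `ρ_B`. -/
def stateB (η : ℝ) (e : Ensemble n d) : Matrix (Fin 2) (Fin 2) ℂ :=
  traceFst (e.stateXB η)

/-- Coherent information `I(A⟩BX) = H(BX) - H(ABX)`. -/
def coherentInfo (η : ℝ) (e : Ensemble n d) : ℝ :=
  vnEntropy (e.stateXB η) - vnEntropy (e.stateXAB η)

/-- Holevo information `I(X;B) = H(X) + H(B) - H(BX)`. -/
def holevoInfo (η : ℝ) (e : Ensemble n d) : ℝ :=
  vnEntropy (e.stateX η) + vnEntropy (e.stateB η) - vnEntropy (e.stateXB η)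

end Ensemble

/-- The polyhedron of rate pairs `(C, Q)` with `Q ≤ a` and `C + Q ≤ b`. -/
def ratePolyhedron (a b : ℝ) : Set (ℝ × ℝ) := {r | r.2 ≤ a ∧ r.1 + r.2 ≤ b}

/-- The single-letter classical-quantum trade-off region of the amplitude damping channel: the
union, over all ensembles, of `Q ≤ I(A⟩BX)`, `C + Q ≤ I(X;B) + I(A⟩BX)`. -/
def tradeoffRegion (η : ℝ) : Set (ℝ × ℝ) :=
  ⋃ (n : ℕ) (d : ℕ) (e : Ensemble n d),
    ratePolyhedron (e.coherentInfo η) (e.holevoInfo η + e.coherentInfo η)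

end

end AmplitudeDamping

/-!
Apart from the entropy of the letter distribution, which cancels, every entropy involved is a mean
of entropies `E(D)` of qubits of determinant `D`, so a letter enters only through its population `q`
of `|0⟩` and one further real parameter. Time sharing between letters does not help: the set of
triples (population, coherent information, environment entropy) attainable by one letter, closed
downwards in the second and upwards in the third entry, is convex, so the mean over any ensemble is
dominated by one letter. For `η ≤ 1 / 2` the coherent information is nonpositive, and only the
convexity of the least environment entropy in `q` matters. For `1 / 2 < η < 1` the point is that the
output entropy is a jointly concave function of `q` and the environment entropy. Along a segment,
the sign of its second derivative follows from two properties of the elasticity `-d log F / d log D`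
of `F = dE / dD`: it is at most `1 / 2`, and it is increasing in `D`.

Conversely, if each letter is sent with both signs of its coherence, then the coherences cancel in
`ρ_B`, whose entropy becomes `h₂(η p)`, while all conditional entropies are unchanged.
-/

namespace AmplitudeDamping

open Set

section Artanh

lemma one_sub_sq_pos {x : ℝ} (hx : x ∈ Ioo (-1 : ℝ) 1) : 0 < 1 - x ^ 2 := by
  nlinarith [hx.1, hx.2]

lemma Ico_zero_one_subset : Ico (0 : ℝ) 1 ⊆ Ioo (-1) 1 :=
  fun _ hx => ⟨by linarith [hx.1], hx.2⟩

lemma nonneg_of_hasDerivAt_nonneg {f f' : ℝ → ℝ} {a b r : ℝ} (ha : 0 ≤ f a)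
    (hf : ∀ x ∈ Ico a b, HasDerivAt f (f' x) x) (hf' : ∀ x ∈ Ioo a b, 0 ≤ f' x)
    (hr : r ∈ Ico a b) : 0 ≤ f r := by
  have hmono : MonotoneOn f (Ico a b) :=
    monotoneOn_of_hasDerivWithinAt_nonneg (convex_Ico a b)
      (fun x hx => (hf x hx).continuousAt.continuousWithinAt)
      (fun x hx => (hf x (interior_subset hx)).hasDerivWithinAt)
      (fun x hx => hf' x (interior_Ico (a := a) (b := b) ▸ hx))
  exact ha.trans (hmono ⟨le_rfl, hr.1.trans_lt hr.2⟩ hr hr.1)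

lemma hasDerivAt_artanh {r : ℝ} (hr : r ∈ Ioo (-1 : ℝ) 1) :
    HasDerivAt Real.artanh (1 / (1 - r ^ 2)) r := by
  have ha : 0 < 1 + r := by linarith [hr.1]
  have hb : 0 < 1 - r := by linarith [hr.2]
  have hc := one_sub_sq_pos hr
  have h := (((hasDerivAt_id r).const_add 1).div ((hasDerivAt_id r).const_sub 1) hb.ne').log
    (div_pos ha hb).ne' |>.const_mul (1 / 2)
  refine (h.congr_deriv ?_).congr_of_eventuallyEq ?_
  · simp only [id, Pi.div_apply]
    field_simp
    ring
  · filter_upwards [Icc_mem_nhds hr.1 hr.2] with x hx using Real.artanh_eq_half_log hx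

lemma le_artanh {r : ℝ} (hr : r ∈ Ico (0 : ℝ) 1) : r ≤ Real.artanh r := by
  refine sub_nonneg.mp <| nonneg_of_hasDerivAt_nonneg (f := fun x => Real.artanh x - x)
    (f' := fun x => 1 / (1 - x ^ 2) - 1) (by simp)
    (fun x hx => (hasDerivAt_artanh (Ico_zero_one_subset hx)).sub (hasDerivAt_id x))
    (fun x hx => ?_) hr
  rw [sub_nonneg, le_div_iff₀ (one_sub_sq_pos (Ico_zero_one_subset (Ioo_subset_Ico_self hx)))]
  nlinarith [sq_nonneg x]

-- The right-hand side is chosen to settle the sign of the derivative in `two_mul_artanh_sq_le`.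
lemma artanh_le_mul_div {r : ℝ} (hr : r ∈ Ico (0 : ℝ) 1) :
    Real.artanh r ≤ r * (3 - r ^ 2) / ((1 - r ^ 2) * (3 + r ^ 2)) := by
  refine sub_nonneg.mp <| nonneg_of_hasDerivAt_nonneg
    (f := fun x => x * (3 - x ^ 2) / ((1 - x ^ 2) * (3 + x ^ 2)) - Real.artanh x)
    (f' := fun x => 16 * x ^ 4 / ((1 - x ^ 2) * (3 + x ^ 2)) ^ 2) (by simp)
    (fun x hx => ?_) (fun x _ => by positivity) hr
  have h := one_sub_sq_pos (Ico_zero_one_subset hx)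
  have hx2 : HasDerivAt (fun y : ℝ => y ^ 2) (2 * x) x := by simpa using hasDerivAt_pow 2 x
  have hN := (hasDerivAt_id x).mul (hx2.const_sub 3)
  have hD := (hx2.const_sub 1).mul (hx2.const_add 3)
  have hP : (1 - x ^ 2) * (3 + x ^ 2) ≠ 0 := by positivity
  refine ((hN.div hD hP).sub (hasDerivAt_artanh (Ico_zero_one_subset hx))).congr_deriv ?_
  simp only [id, Pi.mul_apply]
  field_simp
  ring

lemma artanh_lt_div {r : ℝ} (hr : r ∈ Ioo (0 : ℝ) 1) : Real.artanh r < r / (1 - r ^ 2) := by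
  have hr' := Ioo_subset_Ico_self hr
  have h := one_sub_sq_pos (Ico_zero_one_subset hr')
  have h0 := hr.1
  refine (artanh_le_mul_div hr').trans_lt ?_
  rw [div_lt_div_iff₀ (by positivity) h]
  nlinarith [mul_pos (mul_pos h0 h) (mul_pos h0 h0)]

lemma two_mul_artanh_sq_le {r : ℝ} (hr : r ∈ Ico (0 : ℝ) 1) :
    2 * Real.artanh r ^ 2 ≤ r * Real.artanh r + r ^ 2 / (1 - r ^ 2) := by
  refine sub_nonneg.mp <| nonneg_of_hasDerivAt_nonneg
    (f := fun x => x * Real.artanh x + x ^ 2 / (1 - x ^ 2) - 2 * Real.artanh x ^ 2)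
    (f' := fun x => (3 + x ^ 2) / (1 - x ^ 2) *
      (x * (3 - x ^ 2) / ((1 - x ^ 2) * (3 + x ^ 2)) - Real.artanh x)) (by simp)
    (fun x hx => ?_) (fun x hx => ?_) hr
  · have h := one_sub_sq_pos (Ico_zero_one_subset hx)
    have hx2 : HasDerivAt (fun y : ℝ => y ^ 2) (2 * x) x := by simpa using hasDerivAt_pow 2 x
    have hL := hasDerivAt_artanh (Ico_zero_one_subset hx)
    refine ((((hasDerivAt_id x).mul hL).add (hx2.div (hx2.const_sub 1) h.ne')).sub
      ((hL.pow 2).const_mul 2)).congr_deriv ?_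
    simp only [id]
    field_simp
    ring
  · have hx' := Ioo_subset_Ico_self hx
    have h := one_sub_sq_pos (Ico_zero_one_subset hx')
    exact mul_nonneg (by positivity) (sub_nonneg.mpr (artanh_le_mul_div hx'))

/-- Twice the elasticity `-d log F / d log D` of the derivative `F = dE / dD` of the entropy `E(D)`
of a qubit state of determinant `D`, as a function of the Bloch radius `r = √(1 - 4 D)`. -/
noncomputable def twiceElasticity (r : ℝ) : ℝ := 1 / (r * Real.artanh r) - (1 - r ^ 2) / r ^ 2

variable {r : ℝ}

lemma twiceElasticity_le_one (hr : r ∈ Ioo (0 : ℝ) 1) : twiceElasticity r ≤ 1 := by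
  have h0 := hr.1
  have hL := Real.artanh_pos hr
  have h : twiceElasticity r = 1 - (Real.artanh r - r) / (r ^ 2 * Real.artanh r) := by
    unfold twiceElasticity
    field_simp
    ring
  rw [h, sub_le_self_iff]
  exact div_nonneg (sub_nonneg.mpr (le_artanh (Ioo_subset_Ico_self hr))) (by positivity)

lemma twiceElasticity_pos (hr : r ∈ Ioo (0 : ℝ) 1) : 0 < twiceElasticity r := by
  have h0 := hr.1
  have hL := Real.artanh_pos hr
  have h : twiceElasticity r = (r - Real.artanh r * (1 - r ^ 2)) / (r ^ 2 * Real.artanh r) := by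
    unfold twiceElasticity
    field_simp
  have hlt := artanh_lt_div hr
  rw [lt_div_iff₀ (one_sub_sq_pos (Ico_zero_one_subset (Ioo_subset_Ico_self hr)))] at hlt
  exact h ▸ div_pos (sub_pos.mpr hlt) (by positivity)

lemma hasDerivAt_twiceElasticity (hr : r ∈ Ioo (0 : ℝ) 1) :
    HasDerivAt twiceElasticity ((2 * Real.artanh r ^ 2 - r * Real.artanh r - r ^ 2 / (1 - r ^ 2)) /
      (r ^ 3 * Real.artanh r ^ 2)) r := by
  have h0 := hr.1
  have hL := Real.artanh_pos hr
  have hr' := Ico_zero_one_subset (Ioo_subset_Ico_self hr)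
  have h := one_sub_sq_pos hr'
  have hr2 : HasDerivAt (fun y : ℝ => y ^ 2) (2 * r) r := by simpa using hasDerivAt_pow 2 r
  have h1 := (hasDerivAt_const r (1 : ℝ)).div ((hasDerivAt_id r).mul (hasDerivAt_artanh hr'))
    (by simp only [Pi.mul_apply, id]; positivity)
  refine (h1.sub ((hr2.const_sub 1).div hr2 (by positivity))).congr_deriv ?_
  simp only [id, Pi.mul_apply]
  field_simp
  ring

lemma antitoneOn_twiceElasticity : AntitoneOn twiceElasticity (Ioo 0 1) := by
  refine antitoneOn_of_hasDerivWithinAt_nonpos (convex_Ioo 0 1)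
    (fun x hx => (hasDerivAt_twiceElasticity hx).continuousAt.continuousWithinAt)
    (fun x hx => (hasDerivAt_twiceElasticity (interior_subset hx)).hasDerivWithinAt) fun x hx => ?_
  obtain ⟨h0, h1⟩ := interior_subset hx
  exact div_nonpos_of_nonpos_of_nonneg
    (by linarith [two_mul_artanh_sq_le ⟨h0.le, h1⟩]) (by positivity)

end Artanh

section DetEntropy

/-- Entropy in nats of a qubit state of determinant `D`, whose eigenvalues are
`(1 ± √(1 - 4 D)) / 2`. -/
noncomputable def detEntropy (D : ℝ) : ℝ := Real.binEntropy ((1 + √(1 - 4 * D)) / 2)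

/-- The derivative of `detEntropy` on `(0, 1 / 4)`. -/
noncomputable def detEntropyDeriv (D : ℝ) : ℝ := 2 * Real.artanh √(1 - 4 * D) / √(1 - 4 * D)

/-- Minus the logarithmic derivative of `detEntropyDeriv` on `(0, 1 / 4)`. -/
noncomputable def detEntropyCurv (D : ℝ) : ℝ := twiceElasticity √(1 - 4 * D) / (2 * D)

lemma detEntropy_mul_one_sub (x : ℝ) : detEntropy (x * (1 - x)) = Real.binEntropy x := by
  have h : 1 - 4 * (x * (1 - x)) = (1 - 2 * x) ^ 2 := by ring
  rw [detEntropy, h, Real.sqrt_sq_eq_abs]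
  rcases abs_cases (1 - 2 * x) with ⟨h, -⟩ | ⟨h, -⟩
  · rw [h, ← Real.binEntropy_one_sub]
    congr 1
    ring
  · rw [h]
    congr 1
    ring

lemma detEntropy_zero : detEntropy 0 = 0 := by
  simpa using detEntropy_mul_one_sub 0

lemma detEntropy_quarter : detEntropy (1 / 4) = Real.log 2 := by
  rw [← Real.binEntropy_two_inv, ← detEntropy_mul_one_sub]
  norm_num

@[fun_prop]
lemma continuous_detEntropy : Continuous detEntropy := by
  unfold detEntropy
  fun_prop

lemma strictMonoOn_detEntropy : StrictMonoOn detEntropy (Icc 0 (1 / 4)) := by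
  intro a ha b hb hab
  have hlt : √(1 - 4 * b) < √(1 - 4 * a) :=
    Real.sqrt_lt_sqrt (by linarith [hb.2]) (by linarith)
  have hle : √(1 - 4 * a) ≤ 1 := Real.sqrt_le_one.mpr (by linarith [ha.1])
  have hb0 := Real.sqrt_nonneg (1 - 4 * b)
  exact Real.binEntropy_strictAntiOn ⟨by norm_num; linarith, by linarith⟩
    ⟨by norm_num; linarith, by linarith⟩ (by linarith)

lemma detEntropy_le_detEntropy {a b : ℝ} (ha : 0 ≤ a) (hab : a ≤ b) (hb : b ≤ 1 / 4) :
    detEntropy a ≤ detEntropy b :=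
  strictMonoOn_detEntropy.monotoneOn ⟨ha, hab.trans hb⟩ ⟨ha.trans hab, hb⟩ hab

lemma detEntropy_mem_Icc {D : ℝ} (hD : D ∈ Icc (0 : ℝ) (1 / 4)) :
    detEntropy D ∈ Icc 0 (Real.log 2) := by
  rw [← detEntropy_zero, ← detEntropy_quarter]
  exact ⟨detEntropy_le_detEntropy le_rfl hD.1 hD.2, detEntropy_le_detEntropy hD.1 hD.2 le_rfl⟩

variable {D : ℝ}

lemma sqrt_one_sub_mem_Ioo (hD : D ∈ Ioo (0 : ℝ) (1 / 4)) : √(1 - 4 * D) ∈ Ioo (0 : ℝ) 1 :=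
  ⟨Real.sqrt_pos.mpr (by linarith [hD.2]), (Real.sqrt_lt' one_pos).mpr (by linarith [hD.1])⟩

lemma hasDerivAt_sqrt_one_sub (hD : D < 1 / 4) :
    HasDerivAt (fun D : ℝ => √(1 - 4 * D)) (-2 / √(1 - 4 * D)) D := by
  have h : HasDerivAt (fun D : ℝ => 1 - 4 * D) (-4) D := by
    simpa using ((hasDerivAt_id D).const_mul 4).const_sub 1
  have hs : 0 < √(1 - 4 * D) := Real.sqrt_pos.mpr (by linarith)
  refine (h.sqrt (by linarith)).congr_deriv ?_
  field_simp
  norm_num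

lemma hasDerivAt_detEntropy (hD : D ∈ Ioo (0 : ℝ) (1 / 4)) :
    HasDerivAt detEntropy (detEntropyDeriv D) D := by
  obtain ⟨h0, h1⟩ := sqrt_one_sub_mem_Ioo hD
  have hr := ((hasDerivAt_sqrt_one_sub hD.2).const_add 1).div_const 2
  have hb := Real.hasDerivAt_binEntropy (p := (1 + √(1 - 4 * D)) / 2) (by positivity)
    (by linarith)
  refine (hb.comp D hr).congr_deriv ?_
  have hsub : 1 - (1 + √(1 - 4 * D)) / 2 = (1 - √(1 - 4 * D)) / 2 := by ring
  rw [hsub, Real.log_div (by linarith) two_ne_zero, Real.log_div (by linarith) two_ne_zero,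
    detEntropyDeriv, Real.artanh_eq_half_log ⟨by linarith, h1.le⟩,
    Real.log_div (by linarith) (by linarith)]
  field_simp
  ring

lemma hasDerivAt_detEntropyDeriv (hD : D ∈ Ioo (0 : ℝ) (1 / 4)) :
    HasDerivAt detEntropyDeriv (-(detEntropyDeriv D * detEntropyCurv D)) D := by
  have hs := sqrt_one_sub_mem_Ioo hD
  have hL := Real.artanh_pos hs
  have hr := hasDerivAt_sqrt_one_sub hD.2
  have hA := (hasDerivAt_artanh (Ico_zero_one_subset (Ioo_subset_Ico_self hs))).comp D hr
  refine ((hA.const_mul 2).div hr hs.1.ne').congr_deriv ?_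
  have hsq : √(1 - 4 * D) ^ 2 = 1 - 4 * D := Real.sq_sqrt (by linarith [hD.2])
  simp only [Function.comp_apply, detEntropyDeriv, detEntropyCurv, twiceElasticity]
  have hD_eq : D = (1 - √(1 - 4 * D) ^ 2) / 4 := by
    rw [hsq]
    ring
  have hD0 := hD.1
  have h0 := hs.1
  generalize √(1 - 4 * D) = r at *
  have h1 : 0 < 1 - r ^ 2 := by linarith
  subst hD_eq
  field_simp
  ring

lemma detEntropyDeriv_pos (hD : D ∈ Ioo (0 : ℝ) (1 / 4)) : 0 < detEntropyDeriv D := by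
  have hs := sqrt_one_sub_mem_Ioo hD
  exact div_pos (mul_pos two_pos (Real.artanh_pos hs)) hs.1

lemma detEntropyCurv_pos (hD : D ∈ Ioo (0 : ℝ) (1 / 4)) : 0 < detEntropyCurv D :=
  div_pos (twiceElasticity_pos (sqrt_one_sub_mem_Ioo hD)) (by linarith [hD.1])

lemma two_mul_mul_detEntropyCurv (hD : D ≠ 0) :
    2 * D * detEntropyCurv D = twiceElasticity √(1 - 4 * D) := by
  unfold detEntropyCurv
  field_simp

lemma two_mul_mul_detEntropyCurv_le_one (hD : D ∈ Ioo (0 : ℝ) (1 / 4)) :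
    2 * D * detEntropyCurv D ≤ 1 :=
  (two_mul_mul_detEntropyCurv hD.1.ne').trans_le (twiceElasticity_le_one (sqrt_one_sub_mem_Ioo hD))

lemma monotoneOn_mul_detEntropyCurv :
    MonotoneOn (fun D => D * detEntropyCurv D) (Ioo 0 (1 / 4)) := by
  intro D hD u hu h
  have := antitoneOn_twiceElasticity (sqrt_one_sub_mem_Ioo hu) (sqrt_one_sub_mem_Ioo hD)
    (Real.sqrt_le_sqrt (by linarith : 1 - 4 * u ≤ 1 - 4 * D))
  rw [← two_mul_mul_detEntropyCurv hD.1.ne', ← two_mul_mul_detEntropyCurv hu.1.ne'] at this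
  linarith

section Comp

variable {s : Set ℝ} {u u' u'' : ℝ → ℝ}

lemma hasDerivAt_detEntropyDeriv_comp_mul {t v : ℝ} (hu : u t ∈ Ioo (0 : ℝ) (1 / 4))
    (h : HasDerivAt u (u' t) t) (h' : HasDerivAt u' v t) :
    HasDerivAt (fun t => detEntropyDeriv (u t) * u' t)
      (detEntropyDeriv (u t) * (v - detEntropyCurv (u t) * u' t ^ 2)) t := by
  refine (((hasDerivAt_detEntropyDeriv hu).comp t h).mul h').congr_deriv ?_
  simp only [Function.comp_apply]
  ring

lemma concaveOn_detEntropy_comp (hs : Convex ℝ s) (hc : ContinuousOn u s)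
    (hu : ∀ t ∈ interior s, u t ∈ Ioo (0 : ℝ) (1 / 4))
    (h : ∀ t ∈ interior s, HasDerivAt u (u' t) t)
    (h' : ∀ t ∈ interior s, HasDerivAt u' (u'' t) t)
    (hle : ∀ t ∈ interior s, u'' t ≤ detEntropyCurv (u t) * u' t ^ 2) :
    ConcaveOn ℝ s fun t => detEntropy (u t) :=
  concaveOn_of_hasDerivWithinAt2_nonpos hs (continuous_detEntropy.comp_continuousOn hc)
    (fun t ht => ((hasDerivAt_detEntropy (hu t ht)).comp t (h t ht)).hasDerivWithinAt)
    (fun t ht =>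
      (hasDerivAt_detEntropyDeriv_comp_mul (hu t ht) (h t ht) (h' t ht)).hasDerivWithinAt)
    fun t ht => mul_nonpos_of_nonneg_of_nonpos (detEntropyDeriv_pos (hu t ht)).le
      (sub_nonpos.mpr (hle t ht))

lemma convexOn_detEntropy_comp (hs : Convex ℝ s) (hc : ContinuousOn u s)
    (hu : ∀ t ∈ interior s, u t ∈ Ioo (0 : ℝ) (1 / 4))
    (h : ∀ t ∈ interior s, HasDerivAt u (u' t) t)
    (h' : ∀ t ∈ interior s, HasDerivAt u' (u'' t) t)
    (hle : ∀ t ∈ interior s, detEntropyCurv (u t) * u' t ^ 2 ≤ u'' t) :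
    ConvexOn ℝ s fun t => detEntropy (u t) :=
  convexOn_of_hasDerivWithinAt2_nonneg hs (continuous_detEntropy.comp_continuousOn hc)
    (fun t ht => ((hasDerivAt_detEntropy (hu t ht)).comp t (h t ht)).hasDerivWithinAt)
    (fun t ht =>
      (hasDerivAt_detEntropyDeriv_comp_mul (hu t ht) (h t ht) (h' t ht)).hasDerivWithinAt)
    fun t ht => mul_nonneg (detEntropyDeriv_pos (hu t ht)).le (sub_nonneg.mpr (hle t ht))

end Comp

lemma convexOn_detEntropy_mul_sq {C : ℝ} (hC : C ∈ Icc (0 : ℝ) (1 / 4)) :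
    ConvexOn ℝ (Icc 0 1) fun q : ℝ => detEntropy (C * q ^ 2) := by
  rcases hC.1.eq_or_lt with rfl | h0
  · simpa using convexOn_const _ (convex_Icc (0 : ℝ) 1)
  have hmem : ∀ q ∈ interior (Icc (0 : ℝ) 1), C * q ^ 2 ∈ Ioo (0 : ℝ) (1 / 4) := by
    intro q hq
    rw [interior_Icc] at hq
    have hq0 := hq.1
    have hq1 : q ^ 2 < 1 := pow_lt_one₀ hq0.le hq.2 two_ne_zero
    exact ⟨by positivity, by nlinarith [hC.2]⟩
  refine convexOn_detEntropy_comp (convex_Icc 0 1) (by fun_prop) hmem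
    (u' := fun q => C * (2 * q)) (u'' := fun _ => C * (2 * 1))
    (fun q _ => by simpa using (hasDerivAt_pow 2 q).const_mul C)
    (fun q _ => ((hasDerivAt_id q).const_mul 2).const_mul C) fun q hq => ?_
  have h := mul_le_mul_of_nonneg_left (two_mul_mul_detEntropyCurv_le_one (hmem q hq))
    (by positivity : 0 ≤ 2 * C)
  linarith

end DetEntropy

section DetOfEntropy

lemma image_detEntropy : detEntropy '' Icc 0 (1 / 4) = Icc 0 (Real.log 2) := by
  refine Subset.antisymm (image_subset_iff.mpr fun D hD => detEntropy_mem_Icc hD) ?_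
  simpa only [detEntropy_zero, detEntropy_quarter] using intermediate_value_Icc
    (by norm_num : (0 : ℝ) ≤ 1 / 4) continuous_detEntropy.continuousOn

/-- The determinant of a qubit state as a function of its entropy in nats: the inverse of
`detEntropy` on `[0, log 2]`, with junk values elsewhere. -/
noncomputable def detOfEntropy : ℝ → ℝ := Function.invFunOn detEntropy (Icc 0 (1 / 4))

lemma detOfEntropy_detEntropy {D : ℝ} (hD : D ∈ Icc (0 : ℝ) (1 / 4)) :
    detOfEntropy (detEntropy D) = D :=
  strictMonoOn_detEntropy.injOn.leftInvOn_invFunOn hD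

variable {y : ℝ}

lemma detOfEntropy_mem_Icc (hy : y ∈ Icc 0 (Real.log 2)) :
    detOfEntropy y ∈ Icc (0 : ℝ) (1 / 4) :=
  Function.invFunOn_mem (image_detEntropy.ge hy)

lemma detEntropy_detOfEntropy (hy : y ∈ Icc 0 (Real.log 2)) :
    detEntropy (detOfEntropy y) = y :=
  Function.invFunOn_eq (image_detEntropy.ge hy)

lemma strictMonoOn_detOfEntropy : StrictMonoOn detOfEntropy (Icc 0 (Real.log 2)) := by
  intro a ha b hb hab
  rwa [← strictMonoOn_detEntropy.lt_iff_lt (detOfEntropy_mem_Icc ha) (detOfEntropy_mem_Icc hb),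
    detEntropy_detOfEntropy ha, detEntropy_detOfEntropy hb]

lemma continuousOn_detOfEntropy : ContinuousOn detOfEntropy (Icc 0 (Real.log 2)) := by
  have him : detOfEntropy '' Icc 0 (Real.log 2) = Icc 0 (1 / 4) := by
    rw [← image_detEntropy]
    exact strictMonoOn_detEntropy.injOn.leftInvOn_invFunOn.image_image
  have : OrdConnected (detOfEntropy '' Icc 0 (Real.log 2)) := him ▸ ordConnected_Icc
  rw [continuousOn_iff_continuous_domRestrict]
  exact continuous_subtype_val.comp (strictMonoOn_detOfEntropy.orderIso _ _).continuous

lemma detOfEntropy_mem_Ioo (hy : y ∈ Ioo 0 (Real.log 2)) :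
    detOfEntropy y ∈ Ioo (0 : ℝ) (1 / 4) := by
  have hy' := Ioo_subset_Icc_self hy
  have hD := detOfEntropy_mem_Icc hy'
  have h := detEntropy_detOfEntropy hy'
  refine ⟨hD.1.lt_of_ne fun h0 => hy.1.ne ?_, hD.2.lt_of_ne fun h1 => hy.2.ne' ?_⟩
  · rwa [← h0, detEntropy_zero] at h
  · rwa [h1, detEntropy_quarter] at h

lemma hasDerivAt_detOfEntropy (hy : y ∈ Ioo 0 (Real.log 2)) :
    HasDerivAt detOfEntropy (detEntropyDeriv (detOfEntropy y))⁻¹ y := by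
  have hD := detOfEntropy_mem_Ioo hy
  refine HasDerivAt.of_local_left_inverse
    (continuousOn_detOfEntropy.continuousAt (Icc_mem_nhds hy.1 hy.2))
    (hasDerivAt_detEntropy hD) (detEntropyDeriv_pos hD).ne' ?_
  filter_upwards [Icc_mem_nhds hy.1 hy.2] with x hx using detEntropy_detOfEntropy hx

lemma hasDerivAt_inv_detEntropyDeriv_detOfEntropy (hy : y ∈ Ioo 0 (Real.log 2)) :
    HasDerivAt (fun y => (detEntropyDeriv (detOfEntropy y))⁻¹)
      (detEntropyCurv (detOfEntropy y) * (detEntropyDeriv (detOfEntropy y))⁻¹ ^ 2) y := by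
  have hD := detOfEntropy_mem_Ioo hy
  have hp := (detEntropyDeriv_pos hD).ne'
  refine (((hasDerivAt_detEntropyDeriv hD).comp y (hasDerivAt_detOfEntropy hy)).inv
    hp).congr_deriv ?_
  simp only [Function.comp_apply]
  field_simp

end DetOfEntropy

section Letter

/-- Entropy in nats of the output of the amplitude damping channel of transmissivity `z` on a qubit
with population `q` of `|0⟩` and coherence `c`, where `m = q - |c|²`. The environment of the channel
of transmissivity `η` receives the output of the one of transmissivity `1 - η`. -/
noncomputable def outputEntropy (z q m : ℝ) : ℝ := detEntropy (z * (m - z * q ^ 2))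

variable {z q m : ℝ}

lemma mul_one_sub_mem_Icc (hq : q ∈ Icc (0 : ℝ) 1) : q * (1 - q) ∈ Icc (0 : ℝ) (1 / 4) :=
  ⟨mul_nonneg hq.1 (sub_nonneg.mpr hq.2), by nlinarith [sq_nonneg (q - 1 / 2)]⟩

lemma mul_one_sub_mul_sq_mem_Icc (hz : z ∈ Icc (0 : ℝ) 1) (hq : q ∈ Icc (0 : ℝ) 1) :
    z * (1 - z) * q ^ 2 ∈ Icc (0 : ℝ) (1 / 4) :=
  have h := mul_one_sub_mem_Icc hz
  ⟨mul_nonneg h.1 (sq_nonneg q),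
    (mul_le_of_le_one_right h.1 (pow_le_one₀ hq.1 hq.2)).trans h.2⟩

lemma mem_Icc_zero_one_of_mem_Icc_sq (hm : m ∈ Icc (q ^ 2) q) : q ∈ Icc (0 : ℝ) 1 :=
  ⟨(sq_nonneg q).trans (hm.1.trans hm.2), by nlinarith [hm.1.trans hm.2]⟩

lemma mul_sub_mul_sq_mem_Icc (hz : 0 ≤ z) (hm : m ∈ Icc (q ^ 2) q) :
    z * (m - z * q ^ 2) ∈ Icc (z * (1 - z) * q ^ 2) (z * q * (1 - z * q)) := by
  have := mul_le_mul_of_nonneg_left hm.1 hz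
  have := mul_le_mul_of_nonneg_left hm.2 hz
  constructor <;> linarith

lemma mul_sub_mul_sq_mem_Icc_quarter (hz : z ∈ Icc (0 : ℝ) 1) (hm : m ∈ Icc (q ^ 2) q) :
    z * (m - z * q ^ 2) ∈ Icc (0 : ℝ) (1 / 4) :=
  have hq := mem_Icc_zero_one_of_mem_Icc_sq hm
  Icc_subset_Icc (mul_one_sub_mul_sq_mem_Icc hz hq).1
    (mul_one_sub_mem_Icc (unitInterval.mul_mem hz hq)).2 (mul_sub_mul_sq_mem_Icc hz.1 hm)

lemma outputEntropy_le_binEntropy (hz : z ∈ Icc (0 : ℝ) 1) (hm : m ∈ Icc (q ^ 2) q) :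
    outputEntropy z q m ≤ Real.binEntropy (z * q) :=
  detEntropy_mul_one_sub (z * q) ▸
    detEntropy_le_detEntropy (mul_sub_mul_sq_mem_Icc_quarter hz hm).1
      (mul_sub_mul_sq_mem_Icc hz.1 hm).2
      (mul_one_sub_mem_Icc (unitInterval.mul_mem hz (mem_Icc_zero_one_of_mem_Icc_sq hm))).2

lemma detEntropy_mul_sq_le_outputEntropy (hz : z ∈ Icc (0 : ℝ) 1) (hm : m ∈ Icc (q ^ 2) q) :
    detEntropy (z * (1 - z) * q ^ 2) ≤ outputEntropy z q m :=
  detEntropy_le_detEntropy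
    (mul_one_sub_mul_sq_mem_Icc hz (mem_Icc_zero_one_of_mem_Icc_sq hm)).1
    (mul_sub_mul_sq_mem_Icc hz.1 hm).1 (mul_sub_mul_sq_mem_Icc_quarter hz hm).2

lemma outputEntropy_sq (z q : ℝ) : outputEntropy z q (q ^ 2) = detEntropy (z * (1 - z) * q ^ 2) :=
  congrArg detEntropy (by ring)

lemma outputEntropy_self (z q : ℝ) : outputEntropy z q q = Real.binEntropy (z * q) := by
  rw [← detEntropy_mul_one_sub]
  exact congrArg detEntropy (by ring)

lemma outputEntropy_zero (q m : ℝ) : outputEntropy 0 q m = 0 := by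
  simp [outputEntropy, detEntropy_zero]

/-- The channel of transmissivity `z ≤ 1 / 2` is antidegradable. -/
lemma outputEntropy_le_outputEntropy_one_sub (hz : z ∈ Icc (0 : ℝ) (1 / 2))
    (hm : m ∈ Icc (q ^ 2) q) : outputEntropy z q m ≤ outputEntropy (1 - z) q m := by
  have hz1 : z ∈ Icc (0 : ℝ) 1 := ⟨hz.1, by linarith [hz.2]⟩
  refine detEntropy_le_detEntropy (mul_sub_mul_sq_mem_Icc_quarter hz1 hm).1 ?_
    (mul_sub_mul_sq_mem_Icc_quarter (Icc.one_sub_mem hz1) hm).2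
  have := mul_nonneg (sub_nonneg.mpr hz.2) (sub_nonneg.mpr hm.1)
  linarith

end Letter

section JointConcavity

/-- The pairs `(q, y)` of a population `q` of `|0⟩` and an entropy `y` in nats that the environment
of the amplitude damping channel of transmissivity `η` can have. -/
def envEntropySet (η : ℝ) : Set (ℝ × ℝ) :=
  {x | x.1 ∈ Icc (0 : ℝ) 1 ∧ detEntropy (η * (1 - η) * x.1 ^ 2) ≤ x.2 ∧
    x.2 ≤ Real.binEntropy ((1 - η) * x.1)}

/-- The determinant of the channel output, as a function of the pair `x = (q, y)` of the population
of `|0⟩` in the input and the entropy of the environment. -/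
noncomputable def outputDet (η : ℝ) (x : ℝ × ℝ) : ℝ :=
  η / (1 - η) * detOfEntropy x.2 - η * (2 * η - 1) * x.1 ^ 2

variable {η : ℝ}

lemma mem_envEntropySet_of_mem_Icc_sq {q m : ℝ} (hη : η ∈ Icc (0 : ℝ) 1)
    (hm : m ∈ Icc (q ^ 2) q) : (q, outputEntropy (1 - η) q m) ∈ envEntropySet η := by
  have h := detEntropy_mul_sq_le_outputEntropy (Icc.one_sub_mem hη) hm
  rw [sub_sub_cancel, mul_comm (1 - η)] at h
  exact ⟨mem_Icc_zero_one_of_mem_Icc_sq hm, h,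
    outputEntropy_le_binEntropy (Icc.one_sub_mem hη) hm⟩

lemma outputDet_outputEntropy {q m : ℝ} (hη : η ∈ Ico (0 : ℝ) 1) (hm : m ∈ Icc (q ^ 2) q) :
    outputDet η (q, outputEntropy (1 - η) q m) = η * (m - η * q ^ 2) := by
  have h1 : 1 - η ≠ 0 := (sub_pos.mpr hη.2).ne'
  simp only [outputDet, outputEntropy]
  rw [detOfEntropy_detEntropy
    (mul_sub_mul_sq_mem_Icc_quarter (Icc.one_sub_mem (Ico_subset_Icc_self hη)) hm)]
  field_simp
  ring

lemma convex_envEntropySet (hη : η ∈ Icc (0 : ℝ) 1) : Convex ℝ (envEntropySet η) := by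
  have hlower := (convexOn_detEntropy_mul_sq (mul_one_sub_mem_Icc hη)).convex_epigraph
  have hupper := (Real.strictConcave_binEntropy.concaveOn.comp_linearMap
    (LinearMap.mul ℝ ℝ (1 - η))).convex_hypograph
  convert hlower.inter hupper using 1
  ext x
  have hmul : x.1 ∈ Icc (0 : ℝ) 1 → (1 - η) * x.1 ∈ Icc (0 : ℝ) 1 :=
    unitInterval.mul_mem (Icc.one_sub_mem hη)
  simp only [envEntropySet, mem_ofPred_eq, mem_inter_iff, mem_preimage, LinearMap.mul_apply',
    Function.comp_apply]
  tauto

variable {x y : ℝ × ℝ}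

lemma snd_mem_Icc_of_mem_envEntropySet (hη : η ∈ Icc (0 : ℝ) 1) (hx : x ∈ envEntropySet η) :
    x.2 ∈ Icc 0 (Real.log 2) :=
  ⟨(detEntropy_mem_Icc (mul_one_sub_mul_sq_mem_Icc hη hx.1)).1.trans hx.2.1,
    hx.2.2.trans Real.binEntropy_le_log_two⟩

lemma detOfEntropy_snd_mem_Icc (hη : η ∈ Icc (0 : ℝ) 1) (hx : x ∈ envEntropySet η) :
    detOfEntropy x.2 ∈ Icc (η * (1 - η) * x.1 ^ 2) ((1 - η) * x.1 * (1 - (1 - η) * x.1)) := by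
  have hy := snd_mem_Icc_of_mem_envEntropySet hη hx
  have hD := detOfEntropy_mem_Icc hy
  have hmul := unitInterval.mul_mem (Icc.one_sub_mem hη) hx.1
  constructor
  · rw [← strictMonoOn_detEntropy.le_iff_le (mul_one_sub_mul_sq_mem_Icc hη hx.1) hD,
      detEntropy_detOfEntropy hy]
    exact hx.2.1
  · rw [← strictMonoOn_detEntropy.le_iff_le hD (mul_one_sub_mem_Icc hmul),
      detEntropy_detOfEntropy hy, detEntropy_mul_one_sub]
    exact hx.2.2

lemma exists_outputEntropy_eq (hη : η ∈ Ico (0 : ℝ) 1) (hx : x ∈ envEntropySet η) :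
    ∃ m ∈ Icc (x.1 ^ 2) x.1, outputEntropy (1 - η) x.1 m = x.2 ∧
      outputEntropy η x.1 m = detEntropy (outputDet η x) := by
  have hη' := Ico_subset_Icc_self hη
  have h1 : 0 < 1 - η := sub_pos.mpr hη.2
  obtain ⟨hlower, hupper⟩ := detOfEntropy_snd_mem_Icc hη' hx
  have hdet : (1 - η) * (detOfEntropy x.2 / (1 - η) + (1 - η) * x.1 ^ 2 - (1 - η) * x.1 ^ 2) =
      detOfEntropy x.2 := by
    field_simp
    ring
  refine ⟨detOfEntropy x.2 / (1 - η) + (1 - η) * x.1 ^ 2,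
    ⟨le_of_mul_le_mul_left ?_ h1, le_of_mul_le_mul_left ?_ h1⟩, ?_, congrArg detEntropy ?_⟩
  · linarith
  · linarith
  · rw [outputEntropy, hdet, detEntropy_detOfEntropy (snd_mem_Icc_of_mem_envEntropySet hη' hx)]
  · rw [outputDet]
    field_simp
    ring

lemma fst_eq_zero_of_mem_envEntropySet (hη : η ∈ Ioo (0 : ℝ) 1) (hx : x ∈ envEntropySet η)
    (h : x.2 = 0) : x.1 = 0 := by
  have hle := hx.2.1
  rw [h, ← detEntropy_zero, strictMonoOn_detEntropy.le_iff_le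
    (mul_one_sub_mul_sq_mem_Icc (Ioo_subset_Icc_self hη) hx.1) ⟨le_rfl, by norm_num⟩] at hle
  exact pow_eq_zero_iff two_ne_zero |>.mp <|
    (nonpos_of_mul_nonpos_right hle (mul_pos hη.1 (sub_pos.mpr hη.2))).antisymm (sq_nonneg _)

lemma snd_pos_of_mem_openSegment (hη : η ∈ Ioo (0 : ℝ) 1) (hx : x ∈ envEntropySet η)
    (hy : y ∈ envEntropySet η) (hne : x ≠ y) {w : ℝ × ℝ} (hw : w ∈ openSegment ℝ x y) :
    0 < w.2 := by
  obtain ⟨a, b, ha, hb, -, rfl⟩ := hw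
  have hη' := Ioo_subset_Icc_self hη
  have hx0 := mul_nonneg ha.le (snd_mem_Icc_of_mem_envEntropySet hη' hx).1
  have hy0 := mul_nonneg hb.le (snd_mem_Icc_of_mem_envEntropySet hη' hy).1
  refine (add_nonneg hx0 hy0).lt_of_ne' fun h => hne ?_
  obtain ⟨hx2, hy2⟩ := (add_eq_zero_iff_of_nonneg hx0 hy0).mp h
  replace hx2 := (mul_eq_zero.mp hx2).resolve_left ha.ne'
  replace hy2 := (mul_eq_zero.mp hy2).resolve_left hb.ne'
  exact Prod.ext ((fst_eq_zero_of_mem_envEntropySet hη hx hx2).trans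
    (fst_eq_zero_of_mem_envEntropySet hη hy hy2).symm) (hx2.trans hy2.symm)

lemma snd_lt_binEntropy_of_mem_openSegment (hη : η ∈ Ico (0 : ℝ) 1) (hx : x ∈ envEntropySet η)
    (hy : y ∈ envEntropySet η) (hne : x ≠ y) {w : ℝ × ℝ} (hw : w ∈ openSegment ℝ x y) :
    w.2 < Real.binEntropy ((1 - η) * w.1) := by
  obtain ⟨a, b, ha, hb, hab, rfl⟩ := hw
  have hη' := Icc.one_sub_mem (Ico_subset_Icc_self hη)
  simp only [Prod.snd_add, Prod.smul_snd, Prod.fst_add, Prod.smul_fst, smul_eq_mul]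
  have hx2 := mul_le_mul_of_nonneg_left hx.2.2 ha.le
  have hy2 := mul_le_mul_of_nonneg_left hy.2.2 hb.le
  by_cases h : x.1 = y.1
  · have hsnd : x.2 ≠ y.2 := fun h2 => hne (Prod.ext h h2)
    have hxy := hx.2.2
    have hyx := hy.2.2
    rw [h, ← add_mul, hab, one_mul]
    rw [h] at hxy
    obtain rfl : a = 1 - b := by linarith
    rcases hsnd.lt_or_gt with hlt | hlt <;> nlinarith
  · have hconc := Real.strictConcave_binEntropy.2 (unitInterval.mul_mem hη' hx.1)
      (unitInterval.mul_mem hη' hy.1)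
      (fun h' => h (mul_left_cancel₀ (sub_pos.mpr hη.2).ne' h')) ha hb hab
    simp only [smul_eq_mul, mul_left_comm _ (1 - η), ← mul_add] at hconc
    linarith

lemma snd_mem_Ioo_of_mem_openSegment (hη : η ∈ Ioo (0 : ℝ) 1) (hx : x ∈ envEntropySet η)
    (hy : y ∈ envEntropySet η) (hne : x ≠ y) {w : ℝ × ℝ} (hw : w ∈ openSegment ℝ x y) :
    w.2 ∈ Ioo 0 (Real.log 2) :=
  ⟨snd_pos_of_mem_openSegment hη hx hy hne hw,
    (snd_lt_binEntropy_of_mem_openSegment (Ioo_subset_Ico_self hη) hx hy hne hw).trans_le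
      Real.binEntropy_le_log_two⟩

lemma detOfEntropy_le_outputDet (hη : η ∈ Ico (1 / 2 : ℝ) 1) (hx : x ∈ envEntropySet η) :
    detOfEntropy x.2 ≤ outputDet η x := by
  have h1 : 0 < 1 - η := sub_pos.mpr hη.2
  have h := (detOfEntropy_snd_mem_Icc ⟨by linarith [hη.1], hη.2.le⟩ hx).1
  have heq : outputDet η x - detOfEntropy x.2 =
      (2 * η - 1) / (1 - η) * (detOfEntropy x.2 - η * (1 - η) * x.1 ^ 2) := by
    unfold outputDet
    field_simp
    ring
  rw [← sub_nonneg, heq]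
  exact mul_nonneg (div_nonneg (by linarith [hη.1]) h1.le) (sub_nonneg.mpr h)

lemma outputDet_lt_quarter (hη : η ∈ Ioo (0 : ℝ) 1) (hx : x ∈ envEntropySet η)
    (hlt : x.2 < Real.binEntropy ((1 - η) * x.1)) : outputDet η x < 1 / 4 := by
  have h1 : 0 < 1 - η := sub_pos.mpr hη.2
  have hη' := Ioo_subset_Icc_self hη
  have hy := snd_mem_Icc_of_mem_envEntropySet hη' hx
  have hmul := unitInterval.mul_mem (Icc.one_sub_mem hη') hx.1
  rw [← detEntropy_detOfEntropy hy, ← detEntropy_mul_one_sub,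
    strictMonoOn_detEntropy.lt_iff_lt (detOfEntropy_mem_Icc hy) (mul_one_sub_mem_Icc hmul)] at hlt
  calc outputDet η x
      < outputDet η x +
          η / (1 - η) * ((1 - η) * x.1 * (1 - (1 - η) * x.1) - detOfEntropy x.2) :=
        lt_add_of_pos_right _ (mul_pos (div_pos hη.1 h1) (sub_pos.mpr hlt))
    _ = η * x.1 * (1 - η * x.1) := by
        unfold outputDet
        field_simp
        ring
    _ ≤ 1 / 4 := (mul_one_sub_mem_Icc (unitInterval.mul_mem hη' hx.1)).2

lemma outputDet_mem_Ioo_of_mem_openSegment (hη : η ∈ Ioo (1 / 2 : ℝ) 1)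
    (hx : x ∈ envEntropySet η) (hy : y ∈ envEntropySet η) (hne : x ≠ y) {w : ℝ × ℝ}
    (hw : w ∈ openSegment ℝ x y) : outputDet η w ∈ Ioo (0 : ℝ) (1 / 4) := by
  have hη0 : η ∈ Ioo (0 : ℝ) 1 := ⟨by linarith [hη.1], hη.2⟩
  have hwS := (convex_envEntropySet (Ioo_subset_Icc_self hη0)).openSegment_subset hx hy hw
  exact ⟨(detOfEntropy_mem_Ioo (snd_mem_Ioo_of_mem_openSegment hη0 hx hy hne hw)).1.trans_le
      (detOfEntropy_le_outputDet (Ioo_subset_Ico_self hη) hwS),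
    outputDet_lt_quarter hη0 hwS
      (snd_lt_binEntropy_of_mem_openSegment (Ioo_subset_Ico_self hη0) hx hy hne hw)⟩

lemma mul_sq_le_mul_sq_sub_add {k c q α β X b : ℝ} (hc : 0 ≤ c) (hβ : 0 < 1 + 2 * c * q ^ 2 * β)
    (hk : 0 ≤ k) (h : α * (1 + 2 * c * q ^ 2 * β) ≤ k * β) :
    k * (α * X ^ 2) - 2 * c * b ^ 2 ≤ β * (k * X - c * (2 * q * b)) ^ 2 := by
  rw [sub_le_iff_le_add]
  refine le_of_mul_le_mul_left ?_ hβ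
  -- After multiplication by `1 + 2 * c * q ^ 2 * β`, complete the square in `b`.
  calc (1 + 2 * c * q ^ 2 * β) * (k * (α * X ^ 2))
      = k * X ^ 2 * (α * (1 + 2 * c * q ^ 2 * β)) := by ring
    _ ≤ k * X ^ 2 * (k * β) := mul_le_mul_of_nonneg_left h (by positivity)
    _ ≤ k * X ^ 2 * (k * β) + 2 * c * (b - q * β * (k * X - c * (2 * q * b))) ^ 2 :=
        le_add_of_nonneg_right (by positivity)
    _ = (1 + 2 * c * q ^ 2 * β) * (β * (k * X - c * (2 * q * b)) ^ 2 + 2 * c * b ^ 2) := by ring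

lemma detEntropyCurv_mul_le_mul {k D u : ℝ} (hD : 0 < D) (hDu : D ≤ u) (hu : u < 1 / 4)
    (hk : u ≤ k * D) :
    detEntropyCurv D * (1 + 2 * (k * D - u) * detEntropyCurv u) ≤ k * detEntropyCurv u := by
  have hD' : D ∈ Ioo (0 : ℝ) (1 / 4) := ⟨hD, hDu.trans_lt hu⟩
  have hu' : u ∈ Ioo (0 : ℝ) (1 / 4) := ⟨hD.trans_le hDu, hu⟩
  have hA := detEntropyCurv_pos hu'
  refine le_of_mul_le_mul_left ?_ hD
  calc D * (detEntropyCurv D * (1 + 2 * (k * D - u) * detEntropyCurv u))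
      = D * detEntropyCurv D * (1 + 2 * (k * D - u) * detEntropyCurv u) := by ring
    _ ≤ u * detEntropyCurv u * (1 + 2 * (k * D - u) * detEntropyCurv u) :=
        mul_le_mul_of_nonneg_right (monotoneOn_mul_detEntropyCurv hD' hu' hDu)
          (by have := sub_nonneg.mpr hk; positivity)
    _ = detEntropyCurv u * (u + (k * D - u) * (2 * u * detEntropyCurv u)) := by ring
    _ ≤ detEntropyCurv u * (u + (k * D - u) * 1) :=
        mul_le_mul_of_nonneg_left (add_le_add_right (mul_le_mul_of_nonneg_left
          (two_mul_mul_detEntropyCurv_le_one hu') (sub_nonneg.mpr hk)) u) hA.le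
    _ = D * (k * detEntropyCurv u) := by ring

lemma mul_detEntropyCurv_sub_le {X b : ℝ} (hη : η ∈ Ioo (1 / 2 : ℝ) 1) (hD : 0 < detOfEntropy x.2)
    (hDu : detOfEntropy x.2 ≤ outputDet η x) (hu : outputDet η x < 1 / 4) :
    η / (1 - η) * (detEntropyCurv (detOfEntropy x.2) * X ^ 2) - 2 * (η * (2 * η - 1)) * b ^ 2 ≤
      detEntropyCurv (outputDet η x) *
        (η / (1 - η) * X - η * (2 * η - 1) * (2 * x.1 * b)) ^ 2 := by
  have h0 : 0 < η := by linarith [hη.1]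
  have hk : 0 < η / (1 - η) := div_pos h0 (sub_pos.mpr hη.2)
  have hc : 0 ≤ η * (2 * η - 1) := mul_nonneg h0.le (by linarith [hη.1])
  have hsub : η / (1 - η) * detOfEntropy x.2 - outputDet η x = η * (2 * η - 1) * x.1 ^ 2 :=
    sub_sub_cancel _ _
  have hcq : 0 ≤ η * (2 * η - 1) * x.1 ^ 2 := mul_nonneg hc (sq_nonneg _)
  have hA := detEntropyCurv_pos ⟨hD.trans_le hDu, hu⟩
  have hcurv := detEntropyCurv_mul_le_mul hD hDu hu (sub_nonneg.mp (hsub ▸ hcq))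
  rw [hsub, ← mul_assoc] at hcurv
  exact mul_sq_le_mul_sq_sub_add hc (by nlinarith) hk.le hcurv

lemma hasDerivAt_outputDet {q v : ℝ → ℝ} {q' v' t : ℝ} (hq : HasDerivAt q q' t)
    (hv : HasDerivAt v v' t) (hvt : v t ∈ Ioo 0 (Real.log 2)) :
    HasDerivAt (fun t => outputDet η (q t, v t))
      (η / (1 - η) * ((detEntropyDeriv (detOfEntropy (v t)))⁻¹ * v') -
        η * (2 * η - 1) * (2 * q t * q')) t := by
  refine ((((hasDerivAt_detOfEntropy hvt).comp t hv).const_mul _).sub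
    ((hq.pow 2).const_mul _)).congr_deriv ?_
  simp

lemma concaveOn_detEntropy_outputDet_lineMap (hη : η ∈ Ioo (1 / 2 : ℝ) 1)
    (hx : x ∈ envEntropySet η) (hy : y ∈ envEntropySet η) (hne : x ≠ y) :
    ConcaveOn ℝ (Icc 0 1) fun t : ℝ => detEntropy (outputDet η (AffineMap.lineMap x y t)) := by
  have hη0 : η ∈ Ioo (0 : ℝ) 1 := ⟨by linarith [hη.1], hη.2⟩
  have hη' := Ioo_subset_Icc_self hη0
  let q : ℝ → ℝ := AffineMap.lineMap (k := ℝ) x.1 y.1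
  let v : ℝ → ℝ := AffineMap.lineMap (k := ℝ) x.2 y.2
  have hline (t : ℝ) : AffineMap.lineMap x y t = (q t, v t) :=
    Prod.ext (AffineMap.fst_lineMap ..) (AffineMap.snd_lineMap ..)
  have hqd (t : ℝ) : HasDerivAt q (y.1 - x.1) t := AffineMap.hasDerivAt_lineMap
  have hvd (t : ℝ) : HasDerivAt v (y.2 - x.2) t := AffineMap.hasDerivAt_lineMap
  have hmem : ∀ t ∈ Icc (0 : ℝ) 1, (q t, v t) ∈ envEntropySet η := fun t ht =>
    hline t ▸ (convex_envEntropySet hη').lineMap_mem hx hy ht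
  have hseg : ∀ t ∈ interior (Icc (0 : ℝ) 1), (q t, v t) ∈ openSegment ℝ x y := fun t ht => by
    rw [openSegment_eq_image_lineMap, ← hline]
    exact mem_image_of_mem _ (interior_Icc (a := (0 : ℝ)) ▸ ht)
  have hvm t ht := snd_mem_Ioo_of_mem_openSegment hη0 hx hy hne (hseg t ht)
  have hum t ht := outputDet_mem_Ioo_of_mem_openSegment hη hx hy hne (hseg t ht)
  simp only [hline]
  refine concaveOn_detEntropy_comp (convex_Icc 0 1) ?_ hum
    (fun t ht => hasDerivAt_outputDet (hqd t) (hvd t) (hvm t ht))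
    (fun t ht => ((((hasDerivAt_inv_detEntropyDeriv_detOfEntropy (hvm t ht)).comp t
      (hvd t)).mul_const _).const_mul _).sub
        ((((hqd t).const_mul 2).mul_const _).const_mul _)) fun t ht => ?_
  · exact ((continuousOn_detOfEntropy.comp AffineMap.lineMap_continuous.continuousOn
      fun t ht => snd_mem_Icc_of_mem_envEntropySet hη' (hmem t ht)).const_mul _).sub
      ((AffineMap.lineMap_continuous.pow 2).const_mul _).continuousOn
  · have := mul_detEntropyCurv_sub_le hη
      (X := (detEntropyDeriv (detOfEntropy (v t)))⁻¹ * (y.2 - x.2)) (b := y.1 - x.1)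
      (detOfEntropy_mem_Ioo (hvm t ht)).1
      (detOfEntropy_le_outputDet (Ioo_subset_Ico_self hη) (hmem t (interior_subset ht)))
      (hum t ht).2
    linarith

lemma concaveOn_of_concaveOn_lineMap {E : Type*} [AddCommGroup E] [Module ℝ E] {s : Set E}
    {f : E → ℝ} (hs : Convex ℝ s) (h : ∀ x ∈ s, ∀ y ∈ s, x ≠ y →
      ConcaveOn ℝ (Icc 0 1) fun t : ℝ => f (AffineMap.lineMap x y t)) : ConcaveOn ℝ s f := by
  refine ⟨hs, fun x hx y hy a b ha hb hab => ?_⟩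
  rcases eq_or_ne x y with rfl | hne
  · rw [Convex.combo_self hab, Convex.combo_self hab]
  · have := (h x hx y hy hne).2 (left_mem_Icc.mpr zero_le_one) (right_mem_Icc.mpr zero_le_one)
      ha hb hab
    obtain rfl : a = 1 - b := by linarith
    simpa [AffineMap.lineMap_apply_module] using this

theorem concaveOn_detEntropy_outputDet (hη : η ∈ Ioo (1 / 2 : ℝ) 1) :
    ConcaveOn ℝ (envEntropySet η) fun x => detEntropy (outputDet η x) :=
  concaveOn_of_concaveOn_lineMap
    (convex_envEntropySet ⟨by linarith [hη.1], hη.2.le⟩)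
    fun _ hx _ hy hne => concaveOn_detEntropy_outputDet_lineMap hη hx hy hne

end JointConcavity

section LetterRegion

/-- The triples `(q, a, b)` for which some qubit with population `q` of `|0⟩` has coherent
information at least `a` and environment entropy at most `b` (in nats) at transmissivity `η`. -/
def letterRegion (η : ℝ) : Set (ℝ × ℝ × ℝ) :=
  {x | ∃ m ∈ Icc (x.1 ^ 2) x.1,
    x.2.1 ≤ outputEntropy η x.1 m - outputEntropy (1 - η) x.1 m ∧
      outputEntropy (1 - η) x.1 m ≤ x.2.2}

variable {η : ℝ}

lemma convex_letterRegion_of_concaveOn {S : Set (ℝ × ℝ)} {F : ℝ × ℝ → ℝ} (hF : ConcaveOn ℝ S F)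
    (h : ∀ x, x ∈ letterRegion η ↔ ∃ y ≤ x.2.2, (x.1, y) ∈ S ∧ x.2.1 ≤ F (x.1, y)) :
    Convex ℝ (letterRegion η) := by
  intro x hx x' hx' s t hs ht hst
  obtain ⟨y, hy, hyS, hyF⟩ := (h x).mp hx
  obtain ⟨y', hy', hyS', hyF'⟩ := (h x').mp hx'
  refine (h _).mpr ⟨s * y + t * y', ?_, hF.1 hyS hyS' hs ht hst,
    le_trans ?_ (hF.2 hyS hyS' hs ht hst)⟩
  · exact add_le_add (mul_le_mul_of_nonneg_left hy hs) (mul_le_mul_of_nonneg_left hy' ht)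
  · exact add_le_add (mul_le_mul_of_nonneg_left hyF hs) (mul_le_mul_of_nonneg_left hyF' ht)

lemma convex_letterRegion_of_le_half (hη : η ∈ Icc (0 : ℝ) (1 / 2)) :
    Convex ℝ (letterRegion η) := by
  have hη1 : η ∈ Icc (0 : ℝ) 1 := ⟨hη.1, by linarith [hη.2]⟩
  have hS := (convexOn_detEntropy_mul_sq (mul_one_sub_mem_Icc hη1)).convex_epigraph
  refine convex_letterRegion_of_concaveOn (concaveOn_const (0 : ℝ) hS) fun x =>
    ⟨fun ⟨m, hm, ha, hb⟩ => ?_, fun ⟨y, hy, ⟨hq, hqy⟩, ha⟩ => ?_⟩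
  · exact ⟨_, hb, ⟨mem_Icc_zero_one_of_mem_Icc_sq hm, (mem_envEntropySet_of_mem_Icc_sq hη1 hm).2.1⟩,
      ha.trans (sub_nonpos.mpr (outputEntropy_le_outputEntropy_one_sub hη hm))⟩
  · have henv : outputEntropy (1 - η) x.1 (x.1 ^ 2) = outputEntropy η x.1 (x.1 ^ 2) := by
      simp only [outputEntropy_sq, sub_sub_cancel, mul_comm (1 - η)]
    refine ⟨x.1 ^ 2, ⟨le_rfl, pow_le_of_le_one hq.1 hq.2 two_ne_zero⟩, ?_, ?_⟩
    · rwa [henv, sub_self]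
    · rw [henv, outputEntropy_sq]
      exact hqy.trans hy

lemma convex_letterRegion_one : Convex ℝ (letterRegion 1) := by
  have hF := (Real.strictConcave_binEntropy.concaveOn.comp_linearMap
    (LinearMap.fst ℝ ℝ ℝ)).subset (s := Icc (0 : ℝ) 1 ×ˢ Ici 0) (fun _ hx => hx.1)
    ((convex_Icc _ _).prod (convex_Ici _))
  refine convex_letterRegion_of_concaveOn hF fun x =>
    ⟨fun ⟨m, hm, ha, hb⟩ => ?_, fun ⟨y, hy, ⟨hq, hy0⟩, ha⟩ => ?_⟩
  · rw [sub_self, outputEntropy_zero] at ha hb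
    refine ⟨0, hb, ⟨mem_Icc_zero_one_of_mem_Icc_sq hm, self_mem_Ici⟩, ?_⟩
    simpa using ha.trans (sub_le_sub_right
      (outputEntropy_le_binEntropy ⟨zero_le_one, le_rfl⟩ hm) 0)
  · refine ⟨x.1, ⟨pow_le_of_le_one hq.1 hq.2 two_ne_zero, le_rfl⟩, ?_, ?_⟩ <;>
      rw [sub_self, outputEntropy_zero]
    · rwa [outputEntropy_self, one_mul, sub_zero]
    · exact hy0.trans hy

lemma convex_letterRegion_of_half_lt (hη : η ∈ Ioo (1 / 2 : ℝ) 1) :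
    Convex ℝ (letterRegion η) := by
  have hη0 : η ∈ Ico (0 : ℝ) 1 := ⟨by linarith [hη.1], hη.2⟩
  have hη1 := Ico_subset_Icc_self hη0
  have hF := (concaveOn_detEntropy_outputDet hη).sub
    ((LinearMap.snd ℝ ℝ ℝ).convexOn (convex_envEntropySet hη1))
  refine convex_letterRegion_of_concaveOn hF fun x =>
    ⟨fun ⟨m, hm, ha, hb⟩ => ?_, fun ⟨y, hy, hyS, ha⟩ => ?_⟩
  · refine ⟨_, hb, mem_envEntropySet_of_mem_Icc_sq hη1 hm, ?_⟩
    simp only [Pi.sub_apply, outputDet_outputEntropy hη0 hm]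
    exact ha
  · obtain ⟨m, hm, henv, hout⟩ := exists_outputEntropy_eq hη0 hyS
    refine ⟨m, hm, ?_, henv.trans_le hy⟩
    rw [henv, hout]
    exact ha

theorem convex_letterRegion (hη : η ∈ Icc (0 : ℝ) 1) : Convex ℝ (letterRegion η) := by
  rcases le_or_gt η (1 / 2) with hle | hgt
  · exact convex_letterRegion_of_le_half ⟨hη.1, hle⟩
  rcases hη.2.eq_or_lt with rfl | hlt
  · exact convex_letterRegion_one
  · exact convex_letterRegion_of_half_lt ⟨hgt, hlt⟩

end LetterRegion

section Spectrum

variable {ι κ : Type*} [Fintype ι] [DecidableEq ι] [Fintype κ] [DecidableEq κ]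

lemma vnEntropy_eq_sum_roots {ρ : Matrix ι ι ℂ} (hρ : ρ.IsHermitian) :
    vnEntropy ρ = (ρ.charpoly.roots.map fun c => Real.negMulLog c.re).sum / Real.log 2 := by
  have htrace : vnEntropy ρ = ∑ i, Real.negMulLog (hρ.eigenvalues i) / Real.log 2 := by
    rw [vnEntropy, hρ.cfc_eq, Matrix.IsHermitian.cfc, Unitary.conjStarAlgAut_apply,
      Matrix.trace_mul_cycle, Unitary.coe_star_mul_self, one_mul, Matrix.trace_diagonal,
      Complex.re_sum]
    refine Finset.sum_congr rfl fun i _ => ?_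
    simp only [Function.comp_apply, Real.negMulLog, Real.logb, RCLike.ofReal_eq_complex_ofReal,
      Complex.ofReal_re]
    ring
  rw [htrace, hρ.roots_charpoly_eq_eigenvalues, ← Finset.sum_div, Multiset.map_map]
  rfl

lemma vnEntropy_mul_comm {A : Matrix ι κ ℂ} {B : Matrix κ ι ℂ} (hAB : (A * B).IsHermitian)
    (hBA : (B * A).IsHermitian) : vnEntropy (A * B) = vnEntropy (B * A) := by
  have hroots := congrArg (fun P => (P.roots.map fun c : ℂ => Real.negMulLog c.re).sum)
    (Matrix.charpoly_mul_comm' A B)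
  simp only [Polynomial.roots_mul ((Polynomial.monic_X_pow _).mul
    (Matrix.charpoly_monic _)).ne_zero, Polynomial.roots_X_pow, Multiset.map_add,
    Multiset.map_nsmul, Multiset.map_singleton, Complex.zero_re, Real.negMulLog_zero,
    Multiset.sum_add, Multiset.sum_nsmul, Multiset.sum_singleton, smul_zero, zero_add] at hroots
  rw [vnEntropy_eq_sum_roots hAB, vnEntropy_eq_sum_roots hBA, hroots]

lemma vnEntropy_diagonal (p : ι → ℝ) :
    vnEntropy (Matrix.diagonal fun x => (p x : ℂ)) =
      (∑ x, Real.negMulLog (p x)) / Real.log 2 := by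
  have hp : (Matrix.diagonal fun x => (p x : ℂ)).IsHermitian :=
    Matrix.isHermitian_diagonal_of_self_adjoint _ (funext fun x => Complex.conj_ofReal (p x))
  rw [vnEntropy_eq_sum_roots hp, Matrix.charpoly_diagonal, Polynomial.roots_prod _ _
    (Polynomial.monic_prod_of_monic _ _ fun x _ => Polynomial.monic_X_sub_C _).ne_zero]
  simp

lemma vnEntropy_fin_two {M : Matrix (Fin 2) (Fin 2) ℂ} (hM : M.IsHermitian) {t D : ℝ}
    (hD : D ≤ 1 / 4) (htr : M.trace = t) (hdet : M.det = (t ^ 2 * D : ℝ)) :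
    vnEntropy M = (Real.negMulLog t + t * detEntropy D) / Real.log 2 := by
  set r := (1 + √(1 - 4 * D)) / 2 with hr
  have hrD : r * (1 - r) = D := by
    have hsq : √(1 - 4 * D) ^ 2 = 1 - 4 * D := Real.sq_sqrt (by linarith)
    rw [hr]
    linear_combination -hsq / 4
  have hcharpoly : M.charpoly = (Polynomial.X - Polynomial.C ((t * r : ℝ) : ℂ)) *
      (Polynomial.X - Polynomial.C ((t * (1 - r) : ℝ) : ℂ)) := by
    have htr' : M.trace = (t * r : ℝ) + (t * (1 - r) : ℝ) := by
      rw [htr]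
      push_cast
      ring
    have hdet' : M.det = (t * r : ℝ) * (t * (1 - r) : ℝ) := by
      rw [hdet, ← hrD]
      push_cast
      ring
    rw [Matrix.charpoly_fin_two, htr', hdet', Polynomial.C_add, Polynomial.C_mul]
    ring
  rw [vnEntropy_eq_sum_roots hM, hcharpoly, Polynomial.roots_mul
    ((Polynomial.monic_X_sub_C _).mul (Polynomial.monic_X_sub_C _)).ne_zero,
    Polynomial.roots_X_sub_C, Polynomial.roots_X_sub_C, Multiset.map_add, Multiset.sum_add,
    Multiset.map_singleton, Multiset.map_singleton, Multiset.sum_singleton,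
    Multiset.sum_singleton, Complex.ofReal_re, Complex.ofReal_re, Real.negMulLog_mul,
    Real.negMulLog_mul, detEntropy, Real.binEntropy_eq_negMulLog_add_negMulLog_one_sub]
  ring

end Spectrum

section BlockSum

variable {ι κ τ : Type*} [DecidableEq ι]

/-- The block diagonal matrix `∑ₓ |x⟩⟨x| ⊗ M x`; unlike in `Matrix.blockDiagonal`, the block label
is the first index. -/
def blockSum (M : ι → Matrix κ κ ℂ) : Matrix (ι × κ) (ι × κ) ℂ :=
  Matrix.reindex (Equiv.prodComm κ ι) (Equiv.prodComm κ ι) (Matrix.blockDiagonal M)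

lemma blockSum_apply (M : ι → Matrix κ κ ℂ) (i j : ι × κ) :
    blockSum M i j = if i.1 = j.1 then M i.1 i.2 j.2 else 0 := rfl

lemma isHermitian_blockSum {M : ι → Matrix κ κ ℂ} (hM : ∀ x, (M x).IsHermitian) :
    (blockSum M).IsHermitian :=
  (Matrix.isHermitian_blockDiagonal_iff.mpr hM).submatrix _

lemma traceSnd_blockSum [Fintype κ] (M : ι → Matrix κ κ ℂ) :
    traceSnd (blockSum M) = Matrix.diagonal fun x => (M x).trace := by
  ext x y
  by_cases hxy : x = y <;>
    simp [traceSnd, blockSum_apply, Matrix.trace, hxy]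

lemma traceMid_blockSum [Fintype κ] (M : ι → Matrix (κ × τ) (κ × τ) ℂ) :
    traceMid (blockSum M) = blockSum fun x => traceFst (M x) := by
  ext ⟨x, i⟩ ⟨y, j⟩
  by_cases hxy : x = y <;> simp [traceMid, traceFst, blockSum_apply, hxy]

variable [Fintype ι]

lemma traceFst_blockSum (M : ι → Matrix κ κ ℂ) : traceFst (blockSum M) = ∑ x, M x := by
  ext i j
  simp [traceFst, blockSum_apply, Matrix.sum_apply]

lemma sum_single_kronecker (M : ι → Matrix κ κ ℂ) :
    ∑ x, Matrix.single x x (1 : ℂ) ⊗ₖ M x = blockSum M := by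
  ext ⟨x, i⟩ ⟨y, j⟩
  simp [Matrix.sum_apply, Matrix.single_apply, blockSum_apply, ite_and]

variable [Fintype κ] [DecidableEq κ]

lemma charpoly_blockSum (M : ι → Matrix κ κ ℂ) :
    (blockSum M).charpoly = ∏ x, (M x).charpoly := by
  have hblock : (Matrix.blockDiagonal M).charmatrix =
      Matrix.blockDiagonal fun x => (M x).charmatrix := by
    ext ⟨i, x⟩ ⟨j, y⟩
    by_cases hxy : x = y
    · subst hxy
      simp [Matrix.charmatrix_apply, Matrix.blockDiagonal_apply, Matrix.diagonal_apply]
    · simp [Matrix.blockDiagonal_apply, hxy]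
  rw [blockSum, Matrix.charpoly_reindex, Matrix.charpoly, hblock, Matrix.det_blockDiagonal]
  rfl

lemma vnEntropy_blockSum {M : ι → Matrix κ κ ℂ} (hM : ∀ x, (M x).IsHermitian) :
    vnEntropy (blockSum M) = ∑ x, vnEntropy (M x) := by
  rw [vnEntropy_eq_sum_roots (isHermitian_blockSum hM), charpoly_blockSum,
    Polynomial.roots_prod _ _
    (Polynomial.monic_prod_of_monic _ _ fun x _ => Matrix.charpoly_monic _).ne_zero,
    Multiset.map_bind, Multiset.sum_bind, ← Finset.sum_eq_multiset_sum, Finset.sum_div]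
  exact Finset.sum_congr rfl fun x _ => (vnEntropy_eq_sum_roots (hM x)).symm

end BlockSum

section Qubit

/-- The qubit state with population `q` of `|0⟩` and coherence `c`. -/
def qubit (q : ℝ) (c : ℂ) : Matrix (Fin 2) (Fin 2) ℂ := !![(q : ℂ), c; star c, 1 - q]

lemma isHermitian_smul_qubit (t q : ℝ) (c : ℂ) : ((t : ℂ) • qubit q c).IsHermitian := by
  ext i j
  fin_cases i <;> fin_cases j <;> simp [qubit]

lemma trace_qubit (q : ℝ) (c : ℂ) : (qubit q c).trace = 1 := by
  simp [qubit, Matrix.trace_fin_two]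

lemma det_qubit (q : ℝ) (c : ℂ) : (qubit q c).det = (q * (1 - q) - ‖c‖ ^ 2 : ℝ) := by
  have hc : c * (starRingEnd ℂ) c = (‖c‖ : ℂ) ^ 2 := Complex.mul_conj' c
  simp [qubit, Matrix.det_fin_two, hc]

lemma sum_smul_qubit {ι : Type*} [Fintype ι] {p : ι → ℝ} (hp : ∑ x, p x = 1) (q : ι → ℝ)
    (c : ι → ℂ) :
    ∑ x, (p x : ℂ) • qubit (q x) (c x) = qubit (∑ x, p x * q x) (∑ x, p x * c x) := by
  have hp' : ∑ x, (p x : ℂ) = 1 := by exact_mod_cast hp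
  ext i j
  fin_cases i <;> fin_cases j <;> simp [qubit, Matrix.sum_apply, mul_sub, hp']

lemma convex_setOf_norm_sq_le_mul_one_sub :
    Convex ℝ {x : ℝ × ℂ | ‖x.2‖ ^ 2 ≤ x.1 * (1 - x.1)} := by
  have hnorm : ConvexOn ℝ univ fun x : ℝ × ℂ => ‖x.2‖ ^ 2 :=
    (convexOn_univ_norm.pow (fun _ _ => norm_nonneg _) 2).comp_linearMap (LinearMap.snd ℝ ℝ ℂ)
  have hpow : ConvexOn ℝ univ fun x : ℝ => x ^ 2 := even_two.convexOn_pow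
  have hsq : ConvexOn ℝ univ fun x : ℝ × ℂ => x.1 ^ 2 :=
    hpow.comp_linearMap (LinearMap.fst ℝ ℝ ℂ)
  have hneg : ConvexOn ℝ univ fun x : ℝ × ℂ => -x.1 := (-LinearMap.fst ℝ ℝ ℂ).convexOn convex_univ
  convert ((hnorm.add hsq).add hneg).convex_le 0 using 1
  ext x
  simp only [mem_ofPred_eq, mem_univ, true_and, Pi.add_apply]
  constructor <;> intro h <;> linarith

lemma vnEntropy_smul_qubit (t q : ℝ) (c : ℂ) :
    vnEntropy ((t : ℂ) • qubit q c) =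
      (Real.negMulLog t + t * detEntropy (q * (1 - q) - ‖c‖ ^ 2)) / Real.log 2 := by
  refine vnEntropy_fin_two (isHermitian_smul_qubit t q c) ?_ ?_ ?_
  · nlinarith [sq_nonneg ‖c‖, sq_nonneg (1 - 2 * q)]
  · rw [Matrix.trace_smul, trace_qubit, smul_eq_mul, mul_one]
  · rw [Matrix.det_smul, det_qubit, Fintype.card_fin]
    push_cast
    rfl

lemma vnEntropy_qubit (q : ℝ) (c : ℂ) :
    vnEntropy (qubit q c) = detEntropy (q * (1 - q) - ‖c‖ ^ 2) / Real.log 2 := by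
  simpa using vnEntropy_smul_qubit 1 q c

lemma vnEntropy_blockSum_smul_qubit {ι : Type*} [Fintype ι] [DecidableEq ι] (p q : ι → ℝ)
    (c : ι → ℂ) :
    vnEntropy (blockSum fun x => (p x : ℂ) • qubit (q x) (c x)) =
      (∑ x, Real.negMulLog (p x) + ∑ x, p x * detEntropy (q x * (1 - q x) - ‖c x‖ ^ 2)) /
        Real.log 2 := by
  rw [vnEntropy_blockSum fun x => isHermitian_smul_qubit _ _ _, ← Finset.sum_add_distrib,
    Finset.sum_div]
  exact Finset.sum_congr rfl fun x _ => vnEntropy_smul_qubit _ _ _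

end Qubit

section PartialTrace

variable {α κ : Type*} [Fintype α]

lemma traceFst_smul (c : ℂ) (M : Matrix (α × κ) (α × κ) ℂ) :
    traceFst (c • M) = c • traceFst M := by
  ext i j
  simp [traceFst, Finset.mul_sum]

lemma traceFst_sum {ι : Type*} (s : Finset ι) (M : ι → Matrix (α × κ) (α × κ) ℂ) :
    traceFst (∑ j ∈ s, M j) = ∑ j ∈ s, traceFst (M j) := by
  ext b b'
  simp [traceFst, Matrix.sum_apply, Finset.sum_comm (s := s)]

variable [DecidableEq α] [Fintype κ]

lemma traceFst_one_kronecker_mul_mul (A B : Matrix κ κ ℂ) (M : Matrix (α × κ) (α × κ) ℂ) :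
    traceFst (((1 : Matrix α α ℂ) ⊗ₖ A) * M * ((1 : Matrix α α ℂ) ⊗ₖ B)) =
      A * traceFst M * B := by
  ext b b'
  simp only [traceFst, Matrix.of_apply, Matrix.mul_apply, Fintype.sum_prod_type,
    Matrix.kroneckerMap_apply, Matrix.one_apply, ite_mul, one_mul, zero_mul, mul_ite, mul_zero,
    Finset.sum_ite_eq, Finset.sum_ite_eq', Finset.mem_univ, if_true, Finset.sum_mul,
    Finset.sum_const_zero, Finset.sum_ite_irrel, Finset.mul_sum]
  exact Finset.sum_comm.trans (Finset.sum_congr rfl fun _ _ => Finset.sum_comm)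

lemma trace_one_kronecker_mul (A : Matrix κ κ ℂ) (M : Matrix (α × κ) (α × κ) ℂ) :
    (((1 : Matrix α α ℂ) ⊗ₖ A) * M).trace = (A * traceFst M).trace := by
  simp only [Matrix.trace, Matrix.diag_apply, traceFst, Matrix.of_apply, Matrix.mul_apply,
    Fintype.sum_prod_type, Matrix.kroneckerMap_apply, Matrix.one_apply, ite_mul, one_mul,
    zero_mul, Finset.sum_ite_irrel, Finset.sum_const_zero, Finset.sum_ite_eq, Finset.mem_univ,
    if_true, Finset.mul_sum]
  exact Finset.sum_comm.trans (Finset.sum_congr rfl fun _ _ => Finset.sum_comm)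

lemma star_one_kronecker_mulVec_dotProduct (A B : Matrix κ κ ℂ) (φ : α × κ → ℂ) :
    star (((1 : Matrix α α ℂ) ⊗ₖ A) *ᵥ φ) ⬝ᵥ (((1 : Matrix α α ℂ) ⊗ₖ B) *ᵥ φ) =
      (Aᴴ * B * traceFst (Matrix.vecMulVec φ (star φ))).trace := by
  rw [← trace_one_kronecker_mul, Matrix.mul_vecMulVec, Matrix.trace_vecMulVec,
    dotProduct_comm _ (star φ), Matrix.star_mulVec, ← Matrix.dotProduct_mulVec,
    Matrix.mulVec_mulVec, Matrix.conjTranspose_kronecker, ← Matrix.mul_kronecker_mul,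
    Matrix.conjTranspose_one, one_mul]

end PartialTrace

section ReducedState

variable {α : Type*} [Fintype α] (φ : α × Fin 2 → ℂ)

/-- The weight of `|0⟩` in the reduced qubit state of the vector `φ`. -/
noncomputable def population : ℝ := ∑ a, ‖φ (a, 0)‖ ^ 2

/-- The off-diagonal entry of the reduced qubit state of the vector `φ`. -/
noncomputable def coherence : ℂ := ∑ a, φ (a, 0) * star (φ (a, 1))

/-- The determinant of the reduced qubit state of the vector `φ`, shifted by `population φ ^ 2` so
that damping multiplies it by the transmissivity. -/
noncomputable def mixedness : ℝ := population φ - ‖coherence φ‖ ^ 2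

variable {φ}

lemma sum_norm_sq_snd_one (hφ : ∑ i, ‖φ i‖ ^ 2 = 1) :
    ∑ a, ‖φ (a, 1)‖ ^ 2 = 1 - population φ := by
  rw [← hφ, Fintype.sum_prod_type]
  simp [Fin.sum_univ_two, Finset.sum_add_distrib, population]

lemma norm_coherence_sq_le (hφ : ∑ i, ‖φ i‖ ^ 2 = 1) :
    ‖coherence φ‖ ^ 2 ≤ population φ * (1 - population φ) := by
  have hle : ‖coherence φ‖ ≤ ∑ a, ‖φ (a, 0)‖ * ‖φ (a, 1)‖ :=
    (norm_sum_le _ _).trans (Finset.sum_le_sum fun a _ => by rw [norm_mul, norm_star])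
  rw [← sum_norm_sq_snd_one hφ]
  exact (pow_le_pow_left₀ (norm_nonneg _) hle 2).trans (Finset.sum_mul_sq_le_sq_mul_sq _ _ _)

lemma mixedness_mem_Icc_sq (hφ : ∑ i, ‖φ i‖ ^ 2 = 1) :
    mixedness φ ∈ Icc (population φ ^ 2) (population φ) :=
  ⟨by linarith [norm_coherence_sq_le hφ, mixedness.eq_1 φ], sub_le_self _ (sq_nonneg _)⟩

lemma traceFst_vecMulVec (hφ : ∑ i, ‖φ i‖ ^ 2 = 1) :
    traceFst (Matrix.vecMulVec φ (star φ)) = qubit (population φ) (coherence φ) := by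
  have hsnd : ∑ a, φ (a, 1) * star (φ (a, 1)) = 1 - population φ := by
    rw [← Complex.ofReal_one, ← Complex.ofReal_sub, ← sum_norm_sq_snd_one hφ, Complex.ofReal_sum]
    exact Finset.sum_congr rfl fun a _ => (Complex.mul_conj' _).trans (Complex.ofReal_pow _ _).symm
  have hfst : ∑ a, φ (a, 0) * star (φ (a, 0)) = population φ := by
    rw [population, Complex.ofReal_sum]
    exact Finset.sum_congr rfl fun a _ => (Complex.mul_conj' _).trans (Complex.ofReal_pow _ _).symm
  ext i j
  fin_cases i <;> fin_cases j
  · exact hfst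
  · rfl
  · simp [traceFst, Matrix.vecMulVec_apply, qubit, coherence, mul_comm]
  · exact hsnd

end ReducedState

section Channel

variable {α : Type*} [Fintype α] [DecidableEq α] {η : ℝ}

lemma ofReal_sqrt_mul_self {p : ℝ} (hp : 0 ≤ p) : (√p : ℂ) * √p = p := by
  rw [← Complex.ofReal_mul, Real.mul_self_sqrt hp]

lemma ofReal_sqrt_one_sub_mul_self {p : ℝ} (hp : p ≤ 1) :
    (√(1 - p) : ℂ) * √(1 - p) = 1 - p := by
  exact_mod_cast ofReal_sqrt_mul_self (sub_nonneg.mpr hp)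

lemma norm_sqrt_mul_sq {p : ℝ} (hp : 0 ≤ p) (c : ℂ) : ‖(√p : ℂ) * c‖ ^ 2 = p * ‖c‖ ^ 2 := by
  rw [norm_mul, mul_pow, Complex.norm_real, Real.norm_eq_abs, sq_abs, Real.sq_sqrt hp]

lemma conjTranspose_kraus_zero (η : ℝ) : (kraus η 0)ᴴ = kraus η 0 := by
  ext i j
  fin_cases i <;> fin_cases j <;> simp [kraus]

lemma conjTranspose_kraus_one (η : ℝ) : (kraus η 1)ᴴ = !![0, (√(1 - η) : ℂ); 0, 0] := by
  ext i j
  fin_cases i <;> fin_cases j <;> simp [kraus]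

lemma sum_kraus_mul_qubit_mul (hη : η ∈ Icc (0 : ℝ) 1) (q : ℝ) (c : ℂ) :
    ∑ j, kraus η j * qubit q c * (kraus η j)ᴴ = qubit (η * q) (√η * c) := by
  have hout : (√η : ℂ) * q * √η = η * q := by
    linear_combination (q : ℂ) * ofReal_sqrt_mul_self hη.1
  have henv : 1 - (q : ℂ) + √(1 - η) * q * √(1 - η) = 1 - η * q := by
    linear_combination (q : ℂ) * ofReal_sqrt_one_sub_mul_self hη.2
  rw [Fin.sum_univ_two, conjTranspose_kraus_zero, conjTranspose_kraus_one]
  simp only [kraus, qubit, Matrix.cons_val_zero, Matrix.cons_val_one, Matrix.mul_fin_two]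
  ext i j
  fin_cases i <;> fin_cases j
  · simpa using hout
  · simp
  · simp [mul_comm]
  · simpa using henv

lemma traceFst_dampSnd (M : Matrix (α × Fin 2) (α × Fin 2) ℂ) :
    traceFst (dampSnd η M) = ∑ j, kraus η j * traceFst M * (kraus η j)ᴴ := by
  simp only [dampSnd, traceFst_sum, Matrix.conjTranspose_kronecker, Matrix.conjTranspose_one,
    traceFst_one_kronecker_mul_mul]

/-- The matrix whose columns are the images of the state vector `φ` under the Kraus operators.
With `W` this matrix, the output state is `W * Wᴴ` and the state of the environment is, up to
transposition, `Wᴴ * W`. -/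
noncomputable def krausColumns (η : ℝ) (φ : α × Fin 2 → ℂ) : Matrix (α × Fin 2) (Fin 2) ℂ :=
  Matrix.of fun i j => (((1 : Matrix α α ℂ) ⊗ₖ kraus η j) *ᵥ φ) i

lemma dampSnd_vecMulVec (η : ℝ) (φ : α × Fin 2 → ℂ) :
    dampSnd η (Matrix.vecMulVec φ (star φ)) = krausColumns η φ * (krausColumns η φ)ᴴ := by
  ext i k
  simp only [dampSnd, Matrix.mul_vecMulVec, Matrix.vecMulVec_mul, ← Matrix.star_mulVec]
  simp [krausColumns, Matrix.sum_apply, Matrix.vecMulVec_apply, Matrix.mul_apply]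

lemma conjTranspose_krausColumns_mul (hη : η ∈ Icc (0 : ℝ) 1) {φ : α × Fin 2 → ℂ}
    (hφ : ∑ i, ‖φ i‖ ^ 2 = 1) : (krausColumns η φ)ᴴ * krausColumns η φ =
      qubit (1 - (1 - η) * population φ) (√(1 - η) * coherence φ) := by
  have hentry : ∀ j k, ((krausColumns η φ)ᴴ * krausColumns η φ) j k =
      ((kraus η j)ᴴ * kraus η k * qubit (population φ) (coherence φ)).trace := fun j k => by
    rw [← traceFst_vecMulVec hφ, ← star_one_kronecker_mulVec_dotProduct]
    rfl
  have hpop : (η : ℂ) * population φ + (1 - population φ) = 1 - (1 - η) * population φ := by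
    ring
  ext j k
  rw [hentry]
  fin_cases j <;> fin_cases k
  · simpa [kraus, qubit, Matrix.trace_fin_two, Matrix.mul_apply, ofReal_sqrt_mul_self hη.1]
      using hpop
  · simp [kraus, qubit, Matrix.trace_fin_two, Matrix.mul_apply]
  · simp [kraus, qubit, Matrix.trace_fin_two, Matrix.mul_apply]
  · simp [kraus, qubit, Matrix.trace_fin_two, Matrix.mul_apply, ofReal_sqrt_one_sub_mul_self hη.2]

lemma isHermitian_smul_dampSnd (t η : ℝ) (φ : α × Fin 2 → ℂ) :
    ((t : ℂ) • dampSnd η (Matrix.vecMulVec φ (star φ))).IsHermitian := by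
  rw [dampSnd_vecMulVec]
  exact (Matrix.isHermitian_mul_conjTranspose_self _).smul (Complex.conj_ofReal _)

-- `W * Wᴴ` and `Wᴴ * W` have the same nonzero spectrum: the output and the environment of a pure
-- input are equally entropic.
lemma vnEntropy_smul_dampSnd (hη : η ∈ Icc (0 : ℝ) 1) (t : ℝ) {φ : α × Fin 2 → ℂ}
    (hφ : ∑ i, ‖φ i‖ ^ 2 = 1) :
    vnEntropy ((t : ℂ) • dampSnd η (Matrix.vecMulVec φ (star φ))) =
      vnEntropy ((t : ℂ) •
        qubit (1 - (1 - η) * population φ) (√(1 - η) * coherence φ)) := by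
  have hout := isHermitian_smul_dampSnd t η φ
  have henv := isHermitian_smul_qubit t (1 - (1 - η) * population φ) (√(1 - η) * coherence φ)
  rw [← conjTranspose_krausColumns_mul hη hφ, ← Matrix.mul_smul] at henv ⊢
  rw [dampSnd_vecMulVec, ← Matrix.smul_mul] at hout ⊢
  exact vnEntropy_mul_comm hout henv

end Channel

section StateEntropies

namespace Ensemble

variable {n d : ℕ} (e : Ensemble n d) {η : ℝ}

/-- The mean over the letters of the weight of `|0⟩` in the reduced qubit state. -/
noncomputable def meanPopulation : ℝ := ∑ x, e.prob x * population (e.vec x)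

/-- The mean over the letters of the off-diagonal entry of the reduced qubit state. -/
noncomputable def meanCoherence : ℂ := ∑ x, (e.prob x : ℂ) * coherence (e.vec x)

/-- The mean over the letters of `outputEntropy z`: the conditional entropy in nats of the output
of the channel for `z = η`, and of its environment for `z = 1 - η`. -/
noncomputable def meanOutputEntropy (z : ℝ) : ℝ :=
  ∑ x, e.prob x * outputEntropy z (population (e.vec x)) (mixedness (e.vec x))

lemma stateXAB_eq_blockSum (η : ℝ) : e.stateXAB η = blockSum fun x =>
    (e.prob x : ℂ) • dampSnd η (Matrix.vecMulVec (e.vec x) (star (e.vec x))) := by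
  simp only [stateXAB, ← Matrix.kronecker_smul, sum_single_kronecker]

lemma stateXB_eq_blockSum (hη : η ∈ Icc (0 : ℝ) 1) : e.stateXB η = blockSum fun x =>
    (e.prob x : ℂ) • qubit (η * population (e.vec x)) (√η * coherence (e.vec x)) := by
  simp only [stateXB, stateXAB_eq_blockSum, traceMid_blockSum, traceFst_smul, traceFst_dampSnd,
    traceFst_vecMulVec (e.vec_norm _), sum_kraus_mul_qubit_mul hη]

lemma stateX_eq_diagonal (hη : η ∈ Icc (0 : ℝ) 1) :
    e.stateX η = Matrix.diagonal fun x => (e.prob x : ℂ) := by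
  simp only [stateX, stateXB_eq_blockSum e hη, traceSnd_blockSum, Matrix.trace_smul, trace_qubit,
    smul_eq_mul, mul_one]

lemma stateB_eq_qubit (hη : η ∈ Icc (0 : ℝ) 1) :
    e.stateB η = qubit (η * e.meanPopulation) (√η * e.meanCoherence) := by
  rw [stateB, stateXB_eq_blockSum e hη, traceFst_blockSum, sum_smul_qubit e.prob_sum]
  simp only [meanPopulation, meanCoherence, Finset.mul_sum, mul_left_comm]

lemma vnEntropy_stateXB (hη : η ∈ Icc (0 : ℝ) 1) :
    vnEntropy (e.stateXB η) =
      (∑ x, Real.negMulLog (e.prob x) + e.meanOutputEntropy η) / Real.log 2 := by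
  rw [stateXB_eq_blockSum e hη, vnEntropy_blockSum_smul_qubit]
  simp only [norm_sqrt_mul_sq hη.1, meanOutputEntropy, outputEntropy, mixedness]
  ring_nf

lemma vnEntropy_stateXAB (hη : η ∈ Icc (0 : ℝ) 1) :
    vnEntropy (e.stateXAB η) =
      (∑ x, Real.negMulLog (e.prob x) + e.meanOutputEntropy (1 - η)) / Real.log 2 := by
  rw [stateXAB_eq_blockSum, vnEntropy_blockSum fun x => isHermitian_smul_dampSnd _ _ _]
  simp only [vnEntropy_smul_dampSnd hη _ (e.vec_norm _)]
  rw [← vnEntropy_blockSum fun x => isHermitian_smul_qubit _ _ _, vnEntropy_blockSum_smul_qubit]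
  simp only [norm_sqrt_mul_sq (sub_nonneg.mpr hη.2), meanOutputEntropy, outputEntropy, mixedness]
  ring_nf

lemma coherentInfo_eq (hη : η ∈ Icc (0 : ℝ) 1) :
    e.coherentInfo η = (e.meanOutputEntropy η - e.meanOutputEntropy (1 - η)) / Real.log 2 := by
  rw [coherentInfo, vnEntropy_stateXB e hη, vnEntropy_stateXAB e hη, ← sub_div,
    add_sub_add_left_eq_sub]

lemma holevoInfo_add_coherentInfo_eq (hη : η ∈ Icc (0 : ℝ) 1) :
    e.holevoInfo η + e.coherentInfo η =
      (outputEntropy η e.meanPopulation (e.meanPopulation - ‖e.meanCoherence‖ ^ 2) -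
        e.meanOutputEntropy (1 - η)) / Real.log 2 := by
  rw [holevoInfo, coherentInfo, stateX_eq_diagonal e hη, vnEntropy_diagonal,
    stateB_eq_qubit e hη, vnEntropy_qubit, norm_sqrt_mul_sq hη.1, vnEntropy_stateXAB e hη,
    outputEntropy]
  ring_nf

lemma meanPopulation_sub_mem_Icc_sq :
    e.meanPopulation - ‖e.meanCoherence‖ ^ 2 ∈ Icc (e.meanPopulation ^ 2) e.meanPopulation := by
  have hmem : (e.meanPopulation, e.meanCoherence) ∈
      {x : ℝ × ℂ | ‖x.2‖ ^ 2 ≤ x.1 * (1 - x.1)} := by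
    convert convex_setOf_norm_sq_le_mul_one_sub.sum_mem (t := Finset.univ)
      (fun x _ => e.prob_nonneg x) e.prob_sum
      (z := fun x => (population (e.vec x), coherence (e.vec x)))
      (fun x _ => norm_coherence_sq_le (e.vec_norm x)) using 1
    simp [Prod.ext_iff, Prod.fst_sum, Prod.snd_sum, meanPopulation, meanCoherence]
  exact ⟨by linarith [mem_ofPred.mp hmem], sub_le_self _ (sq_nonneg _)⟩

end Ensemble

end StateEntropies

section TradeoffRegion

lemma h2_eq (y : ℝ) : h2 y = Real.binEntropy y / Real.log 2 := by
  rw [h2, Real.binEntropy_eq_negMulLog_add_negMulLog_one_sub]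
  simp only [Real.negMulLog, Real.logb]
  ring

lemma g_eq (q z ν : ℝ) :
    g q z ν = outputEntropy z q (q - ν ^ 2 * (q * (1 - q))) / Real.log 2 := by
  rw [g, h2_eq, outputEntropy, detEntropy]
  congr 5
  ring

lemma exists_sub_sq_mul_eq {q m : ℝ} (hm : m ∈ Icc (q ^ 2) q) :
    ∃ ν ∈ Icc (0 : ℝ) 1, q - ν ^ 2 * (q * (1 - q)) = m := by
  have hq := mem_Icc_zero_one_of_mem_Icc_sq hm
  rcases (mul_nonneg hq.1 (sub_nonneg.mpr hq.2)).eq_or_lt with hzero | hpos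
  · exact ⟨0, by simp, by linarith [hm.1, hm.2]⟩
  · have hratio : 0 ≤ (q - m) / (q * (1 - q)) := div_nonneg (sub_nonneg.mpr hm.2) hpos.le
    refine ⟨√((q - m) / (q * (1 - q))), ⟨Real.sqrt_nonneg _, ?_⟩, ?_⟩
    · rw [Real.sqrt_le_one, div_le_one hpos]
      linarith [hm.1]
    · rw [Real.sq_sqrt hratio, div_mul_cancel₀ _ hpos.ne', sub_sub_cancel]

lemma Ensemble.exists_letter_info_le {n d : ℕ} (e : Ensemble n d) {η : ℝ}
    (hη : η ∈ Icc (0 : ℝ) 1) :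
    ∃ q ∈ Icc (0 : ℝ) 1, ∃ ν ∈ Icc (0 : ℝ) 1,
      e.coherentInfo η ≤ g q η ν - g q (1 - η) ν ∧
      e.holevoInfo η + e.coherentInfo η ≤ h2 (η * q) - g q (1 - η) ν := by
  have hlog : 0 ≤ Real.log 2 := (Real.log_pos one_lt_two).le
  have hmem : (e.meanPopulation, e.meanOutputEntropy η - e.meanOutputEntropy (1 - η),
      e.meanOutputEntropy (1 - η)) ∈ letterRegion η := by
    convert (convex_letterRegion hη).sum_mem (t := Finset.univ)
      (fun x _ => e.prob_nonneg x) e.prob_sum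
      (z := fun x => (population (e.vec x),
        outputEntropy η (population (e.vec x)) (mixedness (e.vec x)) -
          outputEntropy (1 - η) (population (e.vec x)) (mixedness (e.vec x)),
        outputEntropy (1 - η) (population (e.vec x)) (mixedness (e.vec x))))
      (fun x _ => ⟨_, mixedness_mem_Icc_sq (e.vec_norm x), le_rfl, le_rfl⟩) using 1
    simp [Prod.ext_iff, Prod.fst_sum, Prod.snd_sum, Ensemble.meanPopulation,
      Ensemble.meanOutputEntropy, mul_sub]
  obtain ⟨m, hm, hcoherent, henv⟩ := hmem
  obtain ⟨ν, hν, rfl⟩ := exists_sub_sq_mul_eq hm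
  refine ⟨e.meanPopulation, mem_Icc_zero_one_of_mem_Icc_sq hm, ν, hν, ?_, ?_⟩
  · rw [e.coherentInfo_eq hη, g_eq, g_eq, ← sub_div]
    exact div_le_div_of_nonneg_right hcoherent hlog
  · rw [e.holevoInfo_add_coherentInfo_eq hη, g_eq, h2_eq, ← sub_div]
    exact div_le_div_of_nonneg_right (sub_le_sub
      (outputEntropy_le_binEntropy hη e.meanPopulation_sub_mem_Icc_sq) henv) hlog

/-- The state vector `√q |0⟩|0⟩ + √(1-q) (s |0⟩ + √(1-s²) |1⟩)|1⟩`, for which the reduced qubit has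
population `q` and coherence `s √(q(1-q))`. -/
noncomputable def letterVec (q s : ℝ) : Fin 2 × Fin 2 → ℂ := fun i =>
  !![(√q : ℂ), (s * √(1 - q) : ℂ); 0, (√(1 - s ^ 2) * √(1 - q) : ℂ)] i.1 i.2

lemma sum_norm_sq_letterVec {q s : ℝ} (hq : q ∈ Icc (0 : ℝ) 1) (hs : s ^ 2 ≤ 1) :
    ∑ i, ‖letterVec q s i‖ ^ 2 = 1 := by
  simp [letterVec, Fintype.sum_prod_type, mul_pow, Real.sq_sqrt hq.1,
    Real.sq_sqrt (sub_nonneg.mpr hq.2), Real.sq_sqrt (sub_nonneg.mpr hs)]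
  ring

lemma population_letterVec {q : ℝ} (hq : 0 ≤ q) (s : ℝ) : population (letterVec q s) = q := by
  simp [population, letterVec, Real.sq_sqrt hq]

lemma coherence_letterVec (q s : ℝ) :
    coherence (letterVec q s) = (s * (√q * √(1 - q)) : ℝ) := by
  simp [coherence, letterVec, mul_left_comm]

lemma mixedness_letterVec {q : ℝ} (hq : q ∈ Icc (0 : ℝ) 1) (s : ℝ) :
    mixedness (letterVec q s) = q - s ^ 2 * (q * (1 - q)) := by
  rw [mixedness, population_letterVec hq.1, coherence_letterVec, Complex.norm_real,
    Real.norm_eq_abs, sq_abs, mul_pow, mul_pow, Real.sq_sqrt hq.1,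
    Real.sq_sqrt (sub_nonneg.mpr hq.2)]

section Signed

variable {n : ℕ} {p q ν : Fin n → ℝ} (hp : p ∈ stdSimplex ℝ (Fin n))
  (hq : ∀ x, q x ∈ Icc (0 : ℝ) 1) (hν : ∀ x, ν x ∈ Icc (0 : ℝ) 1)

/-- The ensemble in which the letter vector of parameters `q x`, `ν x` is sent with both signs of
its coherence, each with probability `p x / 2`, so that the coherences cancel in the mean state. -/
noncomputable def signedEnsemble : Ensemble (n + n) 2 where
  prob := Fin.append (fun x => p x / 2) (fun x => p x / 2)
  prob_nonneg := Fin.addCases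
    (fun x => by simpa only [Fin.append_left] using div_nonneg (hp.1 x) zero_le_two)
    (fun x => by simpa only [Fin.append_right] using div_nonneg (hp.1 x) zero_le_two)
  prob_sum := by
    simp only [Fin.sum_univ_add, Fin.append_left, Fin.append_right, ← Finset.sum_add_distrib,
      add_halves, hp.2]
  vec := Fin.append (fun x => letterVec (q x) (ν x)) (fun x => letterVec (q x) (-ν x))
  vec_norm := by
    have hsq : ∀ x, ν x ^ 2 ≤ 1 := fun x => pow_le_one₀ (hν x).1 (hν x).2
    refine Fin.addCases (fun x => ?_) (fun x => ?_)
    · simpa only [Fin.append_left] using sum_norm_sq_letterVec (hq x) (hsq x)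
    · simpa only [Fin.append_right] using
        sum_norm_sq_letterVec (hq x) ((neg_sq (ν x)).trans_le (hsq x))

lemma meanPopulation_signedEnsemble :
    (signedEnsemble hp hq hν).meanPopulation = ∑ x, p x * q x := by
  simp only [Ensemble.meanPopulation, signedEnsemble, Fin.sum_univ_add, Fin.append_left,
    Fin.append_right, population_letterVec (hq _).1, ← Finset.sum_add_distrib, ← add_mul,
    add_halves]

lemma meanCoherence_signedEnsemble : (signedEnsemble hp hq hν).meanCoherence = 0 := by
  simp only [Ensemble.meanCoherence, signedEnsemble, Fin.sum_univ_add, Fin.append_left,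
    Fin.append_right, coherence_letterVec, neg_mul, Complex.ofReal_neg, mul_neg,
    Finset.sum_neg_distrib, add_neg_cancel]

lemma meanOutputEntropy_signedEnsemble (z : ℝ) :
    (signedEnsemble hp hq hν).meanOutputEntropy z / Real.log 2 = ∑ x, p x * g (q x) z (ν x) := by
  simp only [Ensemble.meanOutputEntropy, signedEnsemble, Fin.sum_univ_add, Fin.append_left,
    Fin.append_right, population_letterVec (hq _).1, mixedness_letterVec (hq _), neg_sq,
    ← Finset.sum_add_distrib, ← add_mul, add_halves, Finset.sum_div, g_eq, mul_div_assoc]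

lemma coherentInfo_signedEnsemble {η : ℝ} (hη : η ∈ Icc (0 : ℝ) 1) :
    (signedEnsemble hp hq hν).coherentInfo η =
      ∑ x, p x * (g (q x) η (ν x) - g (q x) (1 - η) (ν x)) := by
  simp only [Ensemble.coherentInfo_eq _ hη, sub_div, meanOutputEntropy_signedEnsemble, mul_sub,
    Finset.sum_sub_distrib]

lemma holevoInfo_add_coherentInfo_signedEnsemble {η : ℝ} (hη : η ∈ Icc (0 : ℝ) 1) :
    (signedEnsemble hp hq hν).holevoInfo η + (signedEnsemble hp hq hν).coherentInfo η =
      h2 (η * ∑ x, p x * q x) - ∑ x, p x * g (q x) (1 - η) (ν x) := by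
  rw [Ensemble.holevoInfo_add_coherentInfo_eq _ hη, sub_div, meanOutputEntropy_signedEnsemble,
    meanCoherence_signedEnsemble, meanPopulation_signedEnsemble, norm_zero,
    zero_pow two_ne_zero, sub_zero, outputEntropy_self, h2_eq]

end Signed

theorem theorem1_general {n : ℕ} [NeZero n] {η : ℝ} (hη : η ∈ Icc (0 : ℝ) 1) :
    tradeoffRegion η =
      {r : ℝ × ℝ | ∃ p ∈ stdSimplex ℝ (Fin n), ∃ q ν : Fin n → ℝ,
        (∀ x, q x ∈ Icc (0 : ℝ) 1) ∧ (∀ x, ν x ∈ Icc (0 : ℝ) 1) ∧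
        r ∈ ratePolyhedron
          (∑ x, p x * (g (q x) η (ν x) - g (q x) (1 - η) (ν x)))
          (h2 (η * ∑ x, p x * q x) - ∑ x, p x * g (q x) (1 - η) (ν x))} := by
  ext r
  simp only [tradeoffRegion, mem_iUnion, mem_ofPred_eq]
  constructor
  · rintro ⟨k, d, e, hQ, hCQ⟩
    obtain ⟨q, hq, ν, hν, hcoherent, htotal⟩ := e.exists_letter_info_le hη
    refine ⟨Pi.single 0 1, single_mem_stdSimplex ℝ 0, fun _ => q, fun _ => ν, fun _ => hq,
      fun _ => hν, ?_⟩
    simpa [Pi.single_apply] using ⟨hQ.trans hcoherent, hCQ.trans htotal⟩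
  · rintro ⟨p, hp, q, ν, hq, hν, hr⟩
    refine ⟨n + n, 2, signedEnsemble hp hq hν, ?_⟩
    rwa [holevoInfo_add_coherentInfo_signedEnsemble hp hq hν hη,
      coherentInfo_signedEnsemble hp hq hν hη]

lemma mem_stdSimplex_fin_two {p : Fin 2 → ℝ} :
    p ∈ stdSimplex ℝ (Fin 2) ↔ p 0 ∈ Icc (0 : ℝ) 1 ∧ p 1 = 1 - p 0 := by
  simp only [stdSimplex, mem_ofPred_eq, Fin.forall_fin_two, Fin.sum_univ_two, mem_Icc]
  constructor
  · rintro ⟨⟨h0, h1⟩, hsum⟩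
    exact ⟨⟨h0, by linarith⟩, by linarith⟩
  · rintro ⟨⟨h0, h1⟩, hp⟩
    exact ⟨⟨h0, by linarith⟩, by linarith⟩

end TradeoffRegion

end AmplitudeDamping

theorem theorem1 (η : ℝ) (hη : η ∈ Set.Icc (0 : ℝ) 1) :
    AmplitudeDamping.tradeoffRegion η =
      {r : ℝ × ℝ | ∃ p q ν : Fin 2 → ℝ,
        p 0 ∈ Set.Icc (0 : ℝ) 1 ∧ p 1 = 1 - p 0 ∧
        (∀ x, q x ∈ Set.Icc (0 : ℝ) 1) ∧ (∀ x, ν x ∈ Set.Icc (0 : ℝ) 1) ∧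
        r ∈ AmplitudeDamping.ratePolyhedron
          (∑ x, p x * (AmplitudeDamping.g (q x) η (ν x)
            - AmplitudeDamping.g (q x) (1 - η) (ν x)))
          (AmplitudeDamping.h2 (η * ∑ x, p x * q x)
            - ∑ x, p x * AmplitudeDamping.g (q x) (1 - η) (ν x))} := by
  rw [AmplitudeDamping.theorem1_general (n := 2) hη]
  simp only [AmplitudeDamping.mem_stdSimplex_fin_two, exists_and_left, and_assoc]
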